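/- Let $d\ge 2$. The $d$-particle PushTASEP is the continuous-time process $\xi_T=(\xi^{(1)}_T,\dots,\xi^{(d)}_T)$ on configurations $\xi^{(1)}<\dots<\xi^{(d)}$ in $\mathbb{Z}$ in which every particle carries an independent exponential clock of rate $1$ (that is, its ring times form a unit-rate Poisson process). When the clock of a particle rings, that particle jumps one site to the right; if the site is occupied, the particle there is pushed one site to the right, and so on, so that the whole block of consecutive particles starting at the ringing particle moves one site to the right. Let $\xi$ be started from an arbitrary deterministic configuration $\xi_0$. Its gap process is $$W_T=\bigl(\xi^{(2)}_T-\xi^{(1)}_T-1,\ \dots,\ \xi^{(d)}_T-\xi^{(d-1)}_T-1\bigr)\in\mathbb{Z}_{\ge 0}^{d-1}.$$ Let $B_d\subset\mathbb{Z}_{\ge 0}^{d-1}$ be the set of points at least one of whose coordinates is $0$, and let $N^{(d)}_T$ be the Lebesgue measure of $\{t\in[0,T]: W_t\in B_d\}$. Then $N^{(d)}_T$ and $\xi^{(i)}_T$ are integrable for all $T\ge 0$ and $1\le i\le d$, and, as $T\to\infty$, $$\mathbb{E}\bigl[N^{(d)}_T\bigr]=\Theta(\sqrt{T}),\qquad \mathbb{E}\bigl[\xi^{(i)}_T\bigr]=T+O(\sqrt{T})\quad\text{for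 every } 1\le i\le d,$$ where the implied constants may depend on $d$ and on the initial configuration $\xi_0$. -/

import Mathlib

open MeasureTheory ProbabilityTheory Filter Asymptotics
open scoped NNReal Topology

namespace PushTASEP

/-- A unit-rate Poisson process on `[0, ∞)`, that is, the number of rings `N t` up to time `t` of an
exponential clock of rate one: it starts at `0`, its paths are nondecreasing and right-continuous,
and its increments are independent with `N t - N s` Poisson distributed of mean `t - s`. -/
structure IsUnitPoissonProcess {Ω : Type*} [MeasurableSpace Ω] (N : ℝ≥0 → Ω → ℕ)
    (μ : Measure Ω) : Prop where
  measurable : ∀ t, Measurable (N t)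
  zero : ∀ᵐ ω ∂μ, N 0 ω = 0
  monotone : ∀ᵐ ω ∂μ, Monotone fun t => N t ω
  rightContinuous : ∀ᵐ ω ∂μ, ∀ t, ContinuousWithinAt (fun s => N s ω) (Set.Ici t) t
  indepIncrements : HasIndepIncrements N μ
  law : ∀ s t, s ≤ t → μ.map (fun ω => N t ω - N s ω) = poissonMeasure (t - s)

/-- The configuration reached from the configuration `x` (with `x 0 < x 1 < ⋯`) when the clock of
particle `i` rings: particle `i`, and every particle `j` to its right such that no site between
`x i` and `x j` is vacant (i.e. `x j - x i = j - i`), moves one site to the right; all others stay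
where they are. -/
def push {d : ℕ} (i : Fin d) (x : Fin d → ℤ) : Fin d → ℤ := fun j =>
  if i ≤ j ∧ x j - x i = (j : ℤ) - (i : ℤ) then x j + 1 else x j

/-- The gap vector `(x₂ - x₁ - 1, …, x_d - x_{d-1} - 1)` of a configuration. -/
def gap {d : ℕ} (x : Fin d → ℤ) : Fin (d - 1) → ℤ := fun i =>
  x ⟨(i : ℕ) + 1, by omega⟩ - x ⟨(i : ℕ), by omega⟩ - 1

/-- The set of points of the nonnegative integer orthant with at least one zero coordinate. -/
def boundary (m : ℕ) : Set (Fin m → ℤ) := {w | (∀ i, 0 ≤ w i) ∧ ∃ i, w i = 0}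

/-- `ξ` is the `d`-particle PushTASEP started from the configuration `x₀` and driven by the clocks
`N 0, …, N (d - 1)`, where `N i t ω` is the number of rings of the clock of particle `i` during
`(0, t]` and `ξ t ω i` is the position of particle `i` at time `t`. The clocks are independent
unit-rate Poisson processes. Almost surely no two clocks ring at the same time and finitely many
rings occur in bounded time, so the fields `start`, `rest` and `jump` determine `ξ` up to a null
set. -/
structure IsPushTASEP {Ω : Type*} [MeasurableSpace Ω] {d : ℕ} (x₀ : Fin d → ℤ)
    (N : Fin d → ℝ≥0 → Ω → ℕ) (ξ : ℝ≥0 → Ω → Fin d → ℤ) (μ : Measure Ω) : Prop where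
  poisson : ∀ i, IsUnitPoissonProcess (N i) μ
  indep : iIndepFun (fun i ω t => N i t ω) μ
  measurable : ∀ t, Measurable (ξ t)
  start : ∀ᵐ ω ∂μ, ξ 0 ω = x₀
  /-- If no clock rings during `(s, t]`, nothing moves. -/
  rest : ∀ᵐ ω ∂μ, ∀ s t, s ≤ t → (∀ j, N j t ω = N j s ω) → ξ t ω = ξ s ω
  /-- If the clock of particle `i` rings exactly once during `(s, t]` and no other clock rings,
  then particle `i` jumps and pushes. -/
  jump : ∀ᵐ ω ∂μ, ∀ s t, s ≤ t → ∀ i, N i t ω = N i s ω + 1 →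
    (∀ j, j ≠ i → N j t ω = N j s ω) → ξ t ω = push i (ξ s ω)

/-- The length of time up to time `T` that the gap process spends on the boundary. -/
noncomputable def boundaryTime {Ω : Type*} {d : ℕ} (ξ : ℝ≥0 → Ω → Fin d → ℤ) (T : ℝ≥0)
    (ω : Ω) : ℝ :=
  (volume {t : ℝ | 0 ≤ t ∧ t ≤ (T : ℝ) ∧ gap (ξ t.toNNReal ω) ∈ boundary (d - 1)}).toReal

end PushTASEP

namespace PushTASEP

/-! ### Deterministic facts on pushes -/

section Push

variable {d : ℕ} {x : Fin d → ℤ}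

/-! The proof is a comparison of drifts. For a test function `f` of at most quadratic growth, a
bound `gen f ≤ a + b * bdryInd` on ordered configurations integrates to `E f(ξ_T) ≤ f(x₀) + a T + b
E[N_T]`, where `N_T` is the boundary time; this is `integral_le_of_gen_le`. It is applied to three
functions.

For the sum of the squared gaps, `gen` is at most `d ^ 2`: a positive gap has no upward drift. Hence
every gap has second moment `O(T)` and mean `O(√T)`. The first particle is never pushed, so it has
mean exactly `x₀ + T`, and adding gaps gives `T + O(√T)` as an upper bound for every particle. The
matching lower bound holds because a particle moves at least once at each of its own rings.

For the sum of the positions, `gen` is at least `d + bdryInd`, since on the boundary some ring moves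
an extra particle. So `E[N_T]` is at most the total displacement in excess of `d T`, which is
`O(√T)`.

For the second particle, `gen` is at most `1 + bdryInd`, so up to the initial distance `E[N_T]` is
at least the mean distance between the first two particles. That distance dominates the positive
part of the difference of two independent Poisson variables of mean `T`, whose mean is of order `√T`
(`mul_sqrt_le_integral_abs_sub`).

The integrated inequality is obtained on a grid of `n` steps. The configuration at a grid time is
independent of the next rings (`indepFun_incr`), a step with at most one ring is described exactly
by `push`, and steps with several rings cost `O(n⁻²)` each, hence nothing in the limit. -/

lemma le_push (i : Fin d) (x : Fin d → ℤ) (j : Fin d) : x j ≤ push i x j := by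
  unfold push; split_ifs <;> omega

lemma push_le (i : Fin d) (x : Fin d → ℤ) (j : Fin d) : push i x j ≤ x j + 1 := by
  unfold push; split_ifs <;> omega

lemma push_self (i : Fin d) (x : Fin d → ℤ) : push i x i = x i + 1 := by
  simp [push]

lemma push_of_lt {i j : Fin d} (h : j < i) (x : Fin d → ℤ) : push i x j = x j := by
  simp [push, not_le.2 h]

lemma add_sub_le_of_strictMono (hx : StrictMono x) {j k : Fin d} (h : j ≤ k) :
    x j + ((k : ℤ) - j) ≤ x k := by
  obtain ⟨j, hj⟩ := j
  obtain ⟨k, hk⟩ := k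
  simp only [Fin.mk_le_mk] at h
  induction k, h using Nat.le_induction with
  | base => simp
  | succ k hjk ih =>
    have h1 := ih (by omega)
    have h2 : x ⟨k, by omega⟩ < x ⟨k + 1, hk⟩ := hx (by simp)
    push_cast at *
    omega

lemma push_strictMono (hx : StrictMono x) (i : Fin d) : StrictMono (push i x) := by
  intro j k hjk
  have h1 := add_sub_le_of_strictMono hx hjk.le
  have h2 := hx hjk
  have h3 : (j : ℕ) < k := hjk
  unfold push
  simp only [Fin.le_def]
  split_ifs <;> omega

/-- The generator of the PushTASEP: the sum over the clocks of the change of `f` at a ring. -/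
def gen (f : (Fin d → ℤ) → ℝ) (x : Fin d → ℤ) : ℝ := ∑ j, (f (push j x) - f x)

lemma gap_mem_boundary (hx : StrictMono x) :
    gap x ∈ boundary (d - 1) ↔ ∃ i, gap x i = 0 := by
  refine ⟨fun h => h.2, fun h => ⟨fun i => ?_, h⟩⟩
  have : x ⟨i, by omega⟩ < x ⟨(i : ℕ) + 1, by omega⟩ := hx (by simp)
  simp only [gap]
  omega

lemma gap_nonneg (hx : StrictMono x) (i : Fin (d - 1)) : 0 ≤ gap x i := by
  have : x ⟨i, by omega⟩ < x ⟨(i : ℕ) + 1, by omega⟩ := hx (by simp)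
  simp only [gap]
  omega

/-- The change of a gap at a ring of clock `j`. -/
lemma gap_push (j : Fin d) (x : Fin d → ℤ) (i : Fin (d - 1)) :
    gap (push j x) i = gap x i +
      ((push j x ⟨(i : ℕ) + 1, by omega⟩ - x ⟨(i : ℕ) + 1, by omega⟩) -
        (push j x ⟨i, by omega⟩ - x ⟨i, by omega⟩)) := by
  simp only [gap]; ring

/-- A positive gap shields its right particle from pushes coming from the left, so only the right
particle's own clock can widen it, while the left particle's clock always narrows it or leaves no
net widening. The linear term in the change of the square thus sums to at most zero, and the
quadratic term is at most one per clock. -/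
lemma sum_gap_push_le (hx : StrictMono x) (i : Fin (d - 1)) :
    ∑ j, (gap (push j x) i ^ 2 - gap x i ^ 2) ≤ d := by
  set a : Fin d := ⟨i, by omega⟩ with ha
  set b : Fin d := ⟨(i : ℕ) + 1, by omega⟩ with hb
  have hab : x a < x b := hx (by simp [ha, hb])
  have hg : gap x i = x b - x a - 1 := rfl
  have key : ∀ j, gap (push j x) i ^ 2 - gap x i ^ 2 ≤
      1 + 2 * gap x i * ((if j = b then 1 else 0) - (if j = a then 1 else 0)) := by
    intro j
    have h1 := le_push j x a
    have h2 := push_le j x a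
    have h3 := le_push j x b
    have h4 := push_le j x b
    have h5 : j = a → push j x a = x a + 1 := by rintro rfl; exact push_self _ _
    -- A push from `j ≤ a` reaches `b` only if all sites from `x j` to `x b` are occupied, which
    -- forces the gap between `a` and `b` to vanish.
    have h6 : gap x i ≠ 0 → j ≠ b → push j x b = x b := by
      intro hne hjb
      have hva : (a : ℕ) = i := rfl
      have hvb : (b : ℕ) = i + 1 := rfl
      have hjv : (j : ℕ) ≠ b := fun h => hjb (Fin.ext h)
      unfold push
      rw [if_neg]
      rintro ⟨h, h'⟩
      have h7 : j ≤ a := by simp only [Fin.le_def] at h ⊢; omega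
      have := add_sub_le_of_strictMono hx h7
      omega
    rw [gap_push, ← ha, ← hb]
    obtain ⟨u, hu⟩ : ∃ u, push j x b - x b = u := ⟨_, rfl⟩
    obtain ⟨v, hv⟩ : ∃ v, push j x a - x a = v := ⟨_, rfl⟩
    rw [hu, hv]
    have hg0 : 0 ≤ gap x i := gap_nonneg hx i
    have hu0 : 0 ≤ u := by omega
    have hu1 : u ≤ 1 := by omega
    have hv0 : 0 ≤ v := by omega
    have hv1 : v ≤ 1 := by omega
    have e1 : u ≤ (if j = b then 1 else 0) ∨ gap x i = 0 := by
      by_cases h : gap x i = 0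
      · exact .inr h
      · left
        split_ifs with hjb
        · exact hu1
        · have := h6 h hjb; omega
    have e2 : (if j = a then 1 else 0) ≤ v := by
      split_ifs with hja
      · have := h5 hja; omega
      · exact hv0
    have e3 : (u - v) ^ 2 ≤ 1 := by
      rw [sq_le_one_iff_abs_le_one, abs_le]; omega
    rcases e1 with e1 | e1
    · nlinarith [mul_nonneg hg0 (sub_nonneg.2 (sub_le_sub e1 e2))]
    · rw [e1]; nlinarith
  refine (Finset.sum_le_sum fun j _ => key j).trans ?_
  simp [Finset.sum_add_distrib, ← Finset.mul_sum]

lemma gen_sum_gap_sq_le (hx : StrictMono x) :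
    gen (fun y => ∑ i, (gap y i : ℝ) ^ 2) x ≤ (d : ℝ) ^ 2 := by
  unfold gen
  simp_rw [← Finset.sum_sub_distrib]
  rw [Finset.sum_comm]
  calc _ ≤ ∑ i : Fin (d - 1), (d : ℝ) :=
        Finset.sum_le_sum fun i _ => by exact_mod_cast sum_gap_push_le hx i
    _ ≤ (d : ℝ) ^ 2 := by
        have : ((d - 1 : ℕ) : ℝ) ≤ d := by exact_mod_cast Nat.sub_le _ _
        simp only [Finset.sum_const, Finset.card_univ, Fintype.card_fin, nsmul_eq_mul]
        nlinarith

open Classical in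
/-- The indicator function of the configurations with gap vector in the boundary. -/
noncomputable def bdryInd (x : Fin d → ℤ) : ℝ := if gap x ∈ boundary (d - 1) then 1 else 0

lemma bdryInd_nonneg (x : Fin d → ℤ) : 0 ≤ bdryInd x := by
  unfold bdryInd; split_ifs <;> norm_num

lemma bdryInd_le_one (x : Fin d → ℤ) : bdryInd x ≤ 1 := by
  unfold bdryInd; split_ifs <;> norm_num

/-- Each ring moves at least the ringing particle, which gives `d`. If some gap is zero, the ring of
the particle on its left moves its right neighbour as well. -/
lemma le_gen_sum (x : Fin d → ℤ) :
    (d : ℝ) + bdryInd x ≤ gen (fun y => ∑ i, (y i : ℝ)) x := by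
  classical
  have hpush : ∀ j i, 0 ≤ ((push j x i : ℤ) : ℝ) - x i := fun j i => by
    exact_mod_cast sub_nonneg.2 (le_push j x i)
  have h1 : ∀ j, 1 ≤ ∑ i, (push j x i : ℝ) - ∑ i, (x i : ℝ) := by
    intro j
    rw [← Finset.sum_sub_distrib]
    refine le_trans ?_ (Finset.single_le_sum (fun i _ => hpush j i) (Finset.mem_univ j))
    rw [push_self]; push_cast; linarith
  have hd : (d : ℝ) = ∑ j : Fin d, 1 := by simp
  unfold gen bdryInd
  split_ifs with h
  · obtain ⟨i, hi⟩ := h.2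
    set a : Fin d := ⟨i, by omega⟩ with ha
    set b : Fin d := ⟨(i : ℕ) + 1, by omega⟩ with hb
    have hg : gap x i = x b - x a - 1 := rfl
    have hab : a ≠ b := by simp [ha, hb]
    have h2 : (1 : ℝ) + 1 ≤ ∑ i, (push a x i : ℝ) - ∑ i, (x i : ℝ) := by
      rw [← Finset.sum_sub_distrib]
      have hpb : push a x b = x b + 1 := by
        unfold push
        rw [if_pos]
        refine ⟨by simp [ha, hb, Fin.le_def], ?_⟩
        simp only [ha, hb] at *
        push_cast
        omega
      calc (1 : ℝ) + 1 = ∑ k ∈ ({a, b} : Finset (Fin d)), ((push a x k : ℝ) - x k) := by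
            rw [Finset.sum_pair hab, push_self, hpb]; push_cast; ring
        _ ≤ _ := Finset.sum_le_sum_of_subset_of_nonneg (Finset.subset_univ _)
            fun k _ _ => hpush a k
    rw [hd]
    have : (1 : ℝ) = ∑ j, if j = a then (1 : ℝ) else 0 := by simp
    nth_rewrite 2 [this]
    rw [← Finset.sum_add_distrib]
    refine Finset.sum_le_sum fun j _ => ?_
    split_ifs with hj
    · rw [hj]; exact h2
    · rw [add_zero]; exact h1 j
  · rw [add_zero, hd]
    exact Finset.sum_le_sum fun j _ => h1 j

/-- The second particle moves only at its own rings, or at those of the first particle when the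
first gap is zero, which is a boundary configuration. -/
lemma gen_second_le (hd : 2 ≤ d) (hx : StrictMono x) :
    gen (fun y => (y ⟨1, hd⟩ : ℝ)) x ≤ 1 + bdryInd x := by
  classical
  set a : Fin d := ⟨0, by omega⟩ with ha
  set b : Fin d := ⟨1, hd⟩ with hb
  have hab : a ≠ b := by simp [ha, hb]
  unfold gen
  have key : ∀ j, ((push j x b : ℤ) : ℝ) - x b ≤
      (if j = b then 1 else 0) + (if j = a then bdryInd x else 0) := by
    intro j
    have h1 : ((push j x b : ℤ) : ℝ) ≤ x b + 1 := by exact_mod_cast push_le j x b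
    by_cases hjb : j = b
    · simp [hjb, hab.symm]; subst hjb; linarith
    by_cases hja : j = a
    · simp only [hja, hab, if_true, if_false, zero_add]
      by_cases hm : gap x ∈ boundary (d - 1)
      · simp only [bdryInd, hm, if_true]; subst hja; linarith
      · rw [gap_mem_boundary hx] at hm
        push Not at hm
        have h2 := hm ⟨0, by omega⟩
        have hg : gap x ⟨0, by omega⟩ = x b - x a - 1 := rfl
        have h3 : push a x b = x b := by
          unfold push
          rw [if_neg]
          rintro ⟨-, h⟩
          simp only [ha, hb] at *
          push_cast at *
          omega
        rw [h3, sub_self]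
        exact bdryInd_nonneg x
    · have : b < j := by
        have h1 : (j : ℕ) ≠ 1 := fun h => hjb (Fin.ext h)
        have h2 : (j : ℕ) ≠ 0 := fun h => hja (Fin.ext h)
        simp only [Fin.lt_def, hb]; omega
      rw [push_of_lt this]
      simp [hja, hjb]
  refine (Finset.sum_le_sum fun j _ => key j).trans ?_
  simp [Finset.sum_add_distrib]

/-- `f` changes by at most a quadratic function of the number of jumps. -/
def QuadGrowth (c : ℝ) (f : (Fin d → ℤ) → ℝ) : Prop :=
  ∀ (x y : Fin d → ℤ) (R : ℕ), 1 ≤ R → (∀ j, x j ≤ y j ∧ y j ≤ x j + R) →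
    |f y - f x| ≤ c * (1 + ∑ j, |(x j : ℝ)|) * (R : ℝ) ^ 2

lemma QuadGrowth.neg {c : ℝ} {f : (Fin d → ℤ) → ℝ} (h : QuadGrowth c f) :
    QuadGrowth c (fun x => -f x) := by
  intro x y R hR hxy
  have := h x y R hR hxy
  rwa [neg_sub_neg, abs_sub_comm]

lemma QuadGrowth.sum {ι : Type*} (s : Finset ι) {c : ℝ} {f : ι → (Fin d → ℤ) → ℝ}
    (h : ∀ i ∈ s, QuadGrowth c (f i)) : QuadGrowth (s.card * c) (fun x => ∑ i ∈ s, f i x) := by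
  intro x y R hR hxy
  rw [← Finset.sum_sub_distrib]
  refine (Finset.abs_sum_le_sum_abs _ _).trans ?_
  refine (Finset.sum_le_sum fun i hi => h i hi x y R hR hxy).trans (le_of_eq ?_)
  simp; ring

lemma quadGrowth_apply (i : Fin d) : QuadGrowth 1 (fun x => (x i : ℝ)) := by
  intro x y R hR hxy
  have h1 : (x i : ℝ) ≤ y i := by exact_mod_cast (hxy i).1
  have h2 : (y i : ℝ) ≤ x i + R := by exact_mod_cast (hxy i).2
  have hR' : (1 : ℝ) ≤ R := by exact_mod_cast hR
  have h3 : 0 ≤ ∑ j, |(x j : ℝ)| := Finset.sum_nonneg fun _ _ => abs_nonneg _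
  rw [abs_le]
  constructor <;> nlinarith [mul_nonneg h3 (sq_nonneg (R : ℝ))]

/-- The change of a square is linear in the old value, hence the factor depending on `x` in
`QuadGrowth`. -/
lemma quadGrowth_gap_sq (i : Fin (d - 1)) : QuadGrowth 5 (fun x => (gap x i : ℝ) ^ 2) := by
  intro x y R hR hxy
  set a : Fin d := ⟨i, by omega⟩ with ha
  set b : Fin d := ⟨(i : ℕ) + 1, by omega⟩ with hb
  have hab : a ≠ b := by simp [ha, hb]
  have h1 : (x a : ℝ) ≤ y a := by exact_mod_cast (hxy a).1
  have h2 : (y a : ℝ) ≤ x a + R := by exact_mod_cast (hxy a).2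
  have h3 : (x b : ℝ) ≤ y b := by exact_mod_cast (hxy b).1
  have h4 : (y b : ℝ) ≤ x b + R := by exact_mod_cast (hxy b).2
  have hR' : (1 : ℝ) ≤ R := by exact_mod_cast hR
  have hgx : (gap x i : ℝ) = x b - x a - 1 := by simp only [gap, ha, hb]; push_cast; ring
  have hgy : (gap y i : ℝ) = y b - y a - 1 := by simp only [gap, ha, hb]; push_cast; ring
  have hs : |(x a : ℝ)| + |(x b : ℝ)| ≤ ∑ j, |(x j : ℝ)| := by
    rw [← Finset.sum_pair (f := fun j => |(x j : ℝ)|) hab]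
    exact Finset.sum_le_sum_of_subset_of_nonneg (Finset.subset_univ _) fun _ _ _ => abs_nonneg _
  set S := ∑ j, |(x j : ℝ)|
  have hg : |(gap x i : ℝ)| ≤ S + 1 := by
    rw [hgx]
    calc |(x b : ℝ) - x a - 1| ≤ |(x b : ℝ)| + |(x a : ℝ)| + 1 := by
          refine (abs_sub _ _).trans ?_
          rw [abs_one]
          gcongr
          exact abs_sub _ _
      _ ≤ _ := by linarith
  have hdiff : |(gap y i : ℝ) - gap x i| ≤ R := by
    rw [hgx, hgy, abs_le]; constructor <;> linarith
  have hS : 0 ≤ S := Finset.sum_nonneg fun _ _ => abs_nonneg _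
  calc |(gap y i : ℝ) ^ 2 - (gap x i : ℝ) ^ 2|
      = |(gap y i : ℝ) - gap x i| * |((gap y i : ℝ) - gap x i) + 2 * gap x i| := by
        rw [← abs_mul]; ring_nf
    _ ≤ R * (R + 2 * (S + 1)) := by
        gcongr
        refine (abs_add_le _ _).trans ?_
        rw [abs_mul, abs_two]
        gcongr
    _ ≤ 5 * (1 + S) * (R : ℝ) ^ 2 := by nlinarith [mul_nonneg hS (sub_nonneg.2 hR')]

end Push

/-! ### Moments of the Poisson distribution -/

section Poisson

lemma hasLaw_integrable_comp {Ω : Type*} [MeasurableSpace Ω] {μ : Measure Ω} {X : Ω → ℕ} {r : ℝ≥0}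
    (hX : HasLaw X (poissonMeasure r) μ) (f : ℕ → ℝ) (hf : Integrable f (poissonMeasure r)) :
    Integrable (fun ω => f (X ω)) μ := by
  have := hX.map_eq ▸ hf
  exact (integrable_map_measure .of_discrete hX.aemeasurable).1 this

lemma hasSum_two_pow_poisson (r : ℝ≥0) :
    HasSum (fun n : ℕ => Real.exp (-r) * (r : ℝ) ^ n / (n.factorial : ℝ) * 2 ^ n) (Real.exp r) := by
  have h := (NormedSpace.expSeries_div_hasSum_exp (2 * r : ℝ)).mul_left (Real.exp (-r))
  rw [← Real.exp_eq_exp_ℝ, ← Real.exp_add] at h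
  convert! h using 1
  · ext n; rw [mul_pow]; ring
  · congr 1; ring

lemma hasSum_id_poisson (r : ℝ≥0) :
    HasSum (fun n : ℕ => Real.exp (-r) * (r : ℝ) ^ n / (n.factorial : ℝ) * (n : ℝ)) r := by
  rw [← hasSum_nat_add_iff' 1]
  have h := (hasSum_one_poissonMeasure r).mul_left (r : ℝ)
  simp only [Finset.range_one, Finset.sum_singleton, Nat.cast_zero, mul_zero, sub_zero]
  convert! h using 1
  · ext n
    rw [Nat.factorial_succ]
    push_cast
    field_simp
    ring
  · simp

lemma integrable_two_pow_poisson (r : ℝ≥0) :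
    Integrable (fun n : ℕ => (2 : ℝ) ^ n) (poissonMeasure r) := by
  rw [integrable_poissonMeasure_iff]
  simpa using (hasSum_two_pow_poisson r).summable

lemma integral_two_pow_poisson (r : ℝ≥0) :
    ∫ n : ℕ, (2 : ℝ) ^ n ∂(poissonMeasure r) = Real.exp r := by
  rw [integral_poissonMeasure]
  exact (hasSum_two_pow_poisson r).tsum_eq

lemma integrable_id_poisson (r : ℝ≥0) :
    Integrable (fun n : ℕ => (n : ℝ)) (poissonMeasure r) := by
  rw [integrable_poissonMeasure_iff]
  simpa using (hasSum_id_poisson r).summable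

lemma integral_id_poisson (r : ℝ≥0) :
    ∫ n : ℕ, (n : ℝ) ∂(poissonMeasure r) = r := by
  rw [integral_poissonMeasure]
  exact (hasSum_id_poisson r).tsum_eq

/-- A nonnegative function vanishing exactly at `0` and `1` and of exponential growth. -/
noncomputable def excess (n : ℕ) : ℝ := 2 ^ n - 1 - n

lemma excess_nonneg (n : ℕ) : 0 ≤ excess n := by
  have := one_add_mul_le_pow (a := (1 : ℝ)) (by norm_num) n
  norm_num at this
  unfold excess
  linarith

/-- The constant is sharp at `n = 2`. With `integral_excess_poisson`, this makes the contribution of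
multiple rings to second moments of second order in the length of the interval. -/
lemma sq_le_excess {n : ℕ} (hn : 2 ≤ n) : (n : ℝ) ^ 2 ≤ 4 * excess n := by
  unfold excess
  induction n, hn using Nat.le_induction with
  | base => norm_num
  | succ n hn ih =>
    have : (2 : ℝ) ≤ n := by exact_mod_cast hn
    rw [pow_succ 2 n]
    push_cast
    nlinarith

lemma one_le_excess {n : ℕ} (hn : 2 ≤ n) : 1 ≤ excess n := by
  have h := sq_le_excess hn
  have : (2 : ℝ) ≤ n := by exact_mod_cast hn
  nlinarith

lemma integrable_excess_poisson (r : ℝ≥0) : Integrable excess (poissonMeasure r) :=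
  ((integrable_two_pow_poisson r).sub (integrable_const _)).sub (integrable_id_poisson r)

lemma integral_excess_poisson (r : ℝ≥0) :
    ∫ n, excess n ∂(poissonMeasure r) = Real.exp r - 1 - r := by
  have h1 : Integrable (fun n : ℕ => (2 : ℝ) ^ n - 1) (poissonMeasure r) :=
    (integrable_two_pow_poisson r).sub (integrable_const _)
  unfold excess
  rw [integral_sub h1 (integrable_id_poisson r),
    integral_sub (integrable_two_pow_poisson r) (integrable_const _),
    integral_two_pow_poisson, integral_id_poisson]
  simp

end Poisson

/-! ### Increments of the clocks -/

section Increments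

variable {Ω : Type*} {d : ℕ}

/-- The number of rings of each clock during `(s, t]`. -/
def incr (N : Fin d → ℝ≥0 → Ω → ℕ) (s t : ℝ≥0) (ω : Ω) : Fin d → ℕ := fun j => N j t ω - N j s ω

/-- The total number of rings during `(s, t]`. -/
def rings (N : Fin d → ℝ≥0 → Ω → ℕ) (s t : ℝ≥0) (ω : Ω) : ℕ := ∑ j, incr N s t ω j

/-- The uniform grid with `n` steps on `[0, T]`. -/
noncomputable def gridTime (T : ℝ≥0) (n k : ℕ) : ℝ≥0 := T * k / n

lemma gridTime_zero (T : ℝ≥0) (n : ℕ) : gridTime T n 0 = 0 := by simp [gridTime]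

lemma gridTime_self (T : ℝ≥0) {n : ℕ} (hn : n ≠ 0) : gridTime T n n = T := by
  have : (n : ℝ≥0) ≠ 0 := by exact_mod_cast hn
  rw [gridTime, mul_div_assoc, div_self this, mul_one]

lemma gridTime_mono (T : ℝ≥0) (n : ℕ) : Monotone (gridTime T n) := by
  intro k l h
  have : (k : ℝ≥0) ≤ l := by exact_mod_cast h
  unfold gridTime
  gcongr

lemma gridTime_succ_sub (T : ℝ≥0) (n k : ℕ) :
    gridTime T n (k + 1) - gridTime T n k = T / n := by
  unfold gridTime
  rw [← tsub_div, ← mul_tsub]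
  simp

lemma coe_gridTime_succ (T : ℝ≥0) (n k : ℕ) :
    (gridTime T n (k + 1) : ℝ) = gridTime T n k + T / n := by
  unfold gridTime
  push_cast
  ring

/-- The second-order error of one grid step, summed over all `n` steps, vanishes in the limit. -/
lemma tendsto_nat_mul_exp_div (c : ℝ) :
    Tendsto (fun n : ℕ => (n : ℝ) * (Real.exp (c / n) - 1 - c / n)) atTop (𝓝 0) := by
  have h0 : Tendsto (fun n : ℕ => c ^ 2 / (n : ℝ)) atTop (𝓝 0) :=
    tendsto_const_div_atTop_nhds_zero_nat _
  have h1 : Tendsto (fun n : ℕ => c / (n : ℝ)) atTop (𝓝 0) :=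
    tendsto_const_div_atTop_nhds_zero_nat _
  refine squeeze_zero' (.of_forall fun n => ?_) ?_ h0
  · have := Real.add_one_le_exp (c / n)
    exact mul_nonneg n.cast_nonneg (by linarith)
  · have h2 := h1.abs
    rw [abs_zero] at h2
    filter_upwards [h2.eventually_le_const one_pos, eventually_gt_atTop 0] with n hn hn0
    have hn' : (0 : ℝ) < n := by exact_mod_cast hn0
    have h3 := (le_abs_self _).trans (Real.abs_exp_sub_one_sub_id_le hn)
    calc (n : ℝ) * (Real.exp (c / n) - 1 - c / n) ≤ n * (c / n) ^ 2 := by gcongr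
      _ = c ^ 2 / n := by field_simp

variable [MeasurableSpace Ω] {μ : Measure Ω} {N : Fin d → ℝ≥0 → Ω → ℕ}

lemma measurable_incr (hN : ∀ i, IsUnitPoissonProcess (N i) μ) (s t : ℝ≥0) :
    Measurable (incr N s t) :=
  measurable_pi_lambda _ fun j => ((hN j).measurable t).sub ((hN j).measurable s)

lemma hasLaw_incr (hN : ∀ i, IsUnitPoissonProcess (N i) μ) {s t : ℝ≥0} (hst : s ≤ t) (j : Fin d) :
    HasLaw (fun ω => incr N s t ω j) (poissonMeasure (t - s)) μ where
  aemeasurable := ((hN j).measurable t).sub ((hN j).measurable s) |>.aemeasurable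
  map_eq := (hN j).law s t hst

lemma iIndepFun_incr (hI : iIndepFun (fun i ω t => N i t ω) μ) (s t : ℝ≥0) :
    iIndepFun (fun j ω => incr N s t ω j) μ :=
  hI.comp (fun _ f => f t - f s) fun _ => (measurable_pi_apply t).sub (measurable_pi_apply s)

variable [IsProbabilityMeasure μ]

lemma hasLaw_rings (hN : ∀ i, IsUnitPoissonProcess (N i) μ)
    (hI : iIndepFun (fun i ω t => N i t ω) μ) {s t : ℝ≥0} (hst : s ≤ t) :
    HasLaw (rings N s t) (poissonMeasure (d * (t - s))) μ := by
  classical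
  have key : ∀ S : Finset (Fin d), HasLaw (∑ j ∈ S, fun ω => incr N s t ω j)
      (poissonMeasure (S.card * (t - s))) μ := by
    intro S
    induction S using Finset.induction_on with
    | empty =>
      simp only [Finset.sum_empty, Finset.card_empty, Nat.cast_zero, zero_mul]
      refine ⟨aemeasurable_const, ?_⟩
      have h0 : poissonMeasure 0 = Measure.dirac 0 := by
        ext A
        rw [poissonMeasure, Measure.sum_apply _ (by trivial), tsum_eq_single 0]
        · simp
        · intro n hn
          simp [hn]
      rw [h0]
      change μ.map (fun _ => 0) = _
      rw [Measure.map_const]; simp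
    | insert a S ha ih =>
      rw [Finset.sum_insert ha, Finset.card_insert_of_notMem ha, add_comm]
      push_cast
      rw [add_mul, one_mul]
      exact ((iIndepFun_incr hI s t).indepFun_finsetSum_of_notMem
        (fun j => ((hN j).measurable t).sub ((hN j).measurable s)) ha).hasLaw_add_poissonMeasure ih
          (hasLaw_incr hN hst a)
  have := key Finset.univ
  rw [Finset.card_univ, Fintype.card_fin] at this
  convert! this using 1
  ext ω
  simp [rings]

/-- Markov's inequality for `excess`, which is at least one as soon as there are two rings. -/
lemma measureReal_two_le_rings (hN : ∀ i, IsUnitPoissonProcess (N i) μ)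
    (hI : iIndepFun (fun i ω t => N i t ω) μ) {s t : ℝ≥0} (hst : s ≤ t) :
    μ.real {ω | 2 ≤ rings N s t ω} ≤
      Real.exp (d * (t - s) : ℝ≥0) - 1 - (d * (t - s) : ℝ≥0) := by
  have hL := hasLaw_rings hN hI hst
  rw [← integral_excess_poisson, ← hL.integral_comp .of_discrete]
  have h := mul_meas_ge_le_integral_of_nonneg (μ := μ) (f := fun ω => excess (rings N s t ω))
    (.of_forall fun ω => excess_nonneg _)
    (hasLaw_integrable_comp hL _ (integrable_excess_poisson _)) 1
  rw [one_mul] at h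
  refine le_trans (measureReal_mono fun ω hω => ?_) h
  exact one_le_excess hω

/-- The event that two clocks, or one clock twice, ring during the same step of the grid. -/
def badEvent (N : Fin d → ℝ≥0 → Ω → ℕ) (T : ℝ≥0) (n : ℕ) : Set Ω :=
  {ω | ∃ k < n, 2 ≤ rings N (gridTime T n k) (gridTime T n (k + 1)) ω}

lemma tendsto_measureReal_badEvent (hN : ∀ i, IsUnitPoissonProcess (N i) μ)
    (hI : iIndepFun (fun i ω t => N i t ω) μ) (T : ℝ≥0) :
    Tendsto (fun n => μ.real (badEvent N T n)) atTop (𝓝 0) := by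
  refine squeeze_zero (fun n => measureReal_nonneg) (fun n => ?_)
    (tendsto_nat_mul_exp_div (d * T))
  have hsub : badEvent N T n ⊆ ⋃ k ∈ Finset.range n,
      {ω | 2 ≤ rings N (gridTime T n k) (gridTime T n (k + 1)) ω} := by
    rintro ω ⟨k, hk, h⟩
    simp only [Set.mem_iUnion, Finset.mem_range]
    exact ⟨k, hk, h⟩
  refine (measureReal_mono hsub (measure_ne_top _ _)).trans ((measureReal_biUnion_finset_le _ _).trans ?_)
  refine (Finset.sum_le_sum fun k _ =>
    measureReal_two_le_rings hN hI (gridTime_mono T n k.le_succ)).trans (le_of_eq ?_)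
  simp only [gridTime_succ_sub]
  simp [mul_div_assoc]
  ring

end Increments

/-! ### Path properties -/

section Path

variable {Ω : Type*} {d : ℕ} {N : Fin d → ℝ≥0 → Ω → ℕ} {ω : Ω}

lemma incr_add (hm : ∀ i, Monotone fun t => N i t ω) {a b c : ℝ≥0} (hab : a ≤ b) (hbc : b ≤ c)
    (j : Fin d) : incr N a c ω j = incr N a b ω j + incr N b c ω j := by
  have h1 : N j a ω ≤ N j b ω := hm j hab
  have h2 : N j b ω ≤ N j c ω := hm j hbc
  simp only [incr]
  omega

lemma rings_add (hm : ∀ i, Monotone fun t => N i t ω) {a b c : ℝ≥0} (hab : a ≤ b) (hbc : b ≤ c) :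
    rings N a c ω = rings N a b ω + rings N b c ω := by
  unfold rings
  rw [← Finset.sum_add_distrib]
  exact Finset.sum_congr rfl fun j _ => incr_add hm hab hbc j

lemma rings_mono (hm : ∀ i, Monotone fun t => N i t ω) {a b s t : ℝ≥0} (ha : a ≤ s) (hs : s ≤ t)
    (hb : t ≤ b) : rings N s t ω ≤ rings N a b ω := by
  rw [rings_add hm ha (hs.trans hb), rings_add hm hs hb]
  omega

lemma rings_self (s : ℝ≥0) : rings N s s ω = 0 := by simp [rings, incr]

lemma incr_le_rings (s t : ℝ≥0) (j : Fin d) : incr N s t ω j ≤ rings N s t ω :=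
  Finset.single_le_sum (f := incr N s t ω) (fun _ _ => Nat.zero_le _) (Finset.mem_univ j)

lemma sum_rings_gridTime (hm : ∀ i, Monotone fun t => N i t ω) (T : ℝ≥0) (n k : ℕ) :
    ∑ l ∈ Finset.range k, rings N (gridTime T n l) (gridTime T n (l + 1)) ω =
      rings N 0 (gridTime T n k) ω := by
  induction k with
  | zero => simp [gridTime_zero, rings_self]
  | succ k ih =>
    rw [Finset.sum_range_succ, ih, ← rings_add hm (zero_le) (gridTime_mono T n k.le_succ)]

lemma incr_eq_single (s t : ℝ≥0) (h : rings N s t ω = 1) :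
    ∃ i, incr N s t ω = Pi.single i 1 := by
  classical
  obtain ⟨i, -, hi⟩ : ∃ i ∈ Finset.univ, incr N s t ω i ≠ 0 := by
    apply Finset.exists_ne_zero_of_sum_ne_zero
    change rings N s t ω ≠ 0
    omega
  have h1 := incr_le_rings (N := N) (ω := ω) s t i
  refine ⟨i, funext fun j => ?_⟩
  by_cases hj : j = i
  · subst hj; simp; omega
  · have h2 : incr N s t ω i + incr N s t ω j ≤ rings N s t ω := by
      rw [← Finset.sum_pair (f := incr N s t ω) (Ne.symm hj)]
      exact Finset.sum_le_sum_of_subset (Finset.subset_univ _)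
    simp [hj]; omega

/-- A transitive relation on times that holds across intervals with at most one ring holds
everywhere. -/
lemma rel_of_not_badEvent (hm : ∀ i, Monotone fun t => N i t ω) {T : ℝ≥0} {n : ℕ} (hn : n ≠ 0)
    (hbad : ω ∉ badEvent N T n) (r : ℝ≥0 → ℝ≥0 → Prop)
    (htrans : ∀ a b c, a ≤ b → b ≤ c → r a b → r b c → r a c)
    (hstep : ∀ s t, s ≤ t → rings N s t ω ≤ 1 → r s t) {s t : ℝ≥0} (hst : s ≤ t) (htT : t ≤ T) :
    r s t := by
  have key : ∀ k ≤ n, ∀ s t, s ≤ t → t ≤ gridTime T n k → r s t := by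
    intro k
    induction k with
    | zero =>
      intro _ s t hst ht
      rw [gridTime_zero, nonpos_iff_eq_zero] at ht
      subst ht
      have : s = 0 := le_antisymm hst (zero_le)
      subst this
      exact hstep 0 0 le_rfl (by simp [rings_self])
    | succ k ih =>
      intro hk s t hst ht
      have hR : rings N (gridTime T n k) (gridTime T n (k + 1)) ω ≤ 1 := by
        by_contra h
        exact hbad ⟨k, by omega, by omega⟩
      rcases le_total t (gridTime T n k) with h1 | h1
      · exact ih (by omega) s t hst h1
      rcases le_total s (gridTime T n k) with h2 | h2
      · exact htrans s _ t h2 h1 (ih (by omega) _ _ h2 le_rfl)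
          (hstep _ _ h1 ((rings_mono hm le_rfl h1 ht).trans hR))
      · exact hstep s t hst ((rings_mono hm h2 hst ht).trans hR)
  exact key n le_rfl s t hst (by rwa [gridTime_self T hn])

variable [MeasurableSpace Ω] {μ : Measure Ω} {x₀ : Fin d → ℤ} {ξ : ℝ≥0 → Ω → Fin d → ℤ}

lemma ae_monotone (hN : ∀ i, IsUnitPoissonProcess (N i) μ) :
    ∀ᵐ ω ∂μ, ∀ i, Monotone fun t => N i t ω :=
  ae_all_iff.2 fun i => (hN i).monotone

lemma ae_step (hξ : IsPushTASEP x₀ N ξ μ) :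
    ∀ᵐ ω ∂μ, ∀ s t, s ≤ t → rings N s t ω ≤ 1 →
      (incr N s t ω = 0 ∧ ξ t ω = ξ s ω) ∨
        ∃ i, incr N s t ω = Pi.single i 1 ∧ ξ t ω = push i (ξ s ω) := by
  filter_upwards [ae_monotone hξ.poisson, hξ.rest, hξ.jump] with ω hm hr hj s t hst hR
  have hN : ∀ j, N j t ω = N j s ω + incr N s t ω j := fun j => by
    have : N j s ω ≤ N j t ω := hm j hst
    simp only [incr]; omega
  rcases Nat.le_one_iff_eq_zero_or_eq_one.1 hR with h | h
  · have h0 : incr N s t ω = 0 := by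
      funext j
      have := incr_le_rings (N := N) (ω := ω) s t j
      simp; omega
    refine .inl ⟨h0, hr s t hst fun j => ?_⟩
    rw [hN j, h0]; simp
  · obtain ⟨i, hi⟩ := incr_eq_single s t h
    refine .inr ⟨i, hi, hj s t hst i ?_ fun j hji => ?_⟩
    · rw [hN i, hi]; simp
    · rw [hN j, hi]; simp [hji]

variable [IsProbabilityMeasure μ]

/-- The exceptional set lies in every `badEvent` with `n ≠ 0`, and their probabilities tend to zero.
Integer horizons suffice and keep the intersection of events countable. -/
lemma ae_exists_notMem_badEvent (hN : ∀ i, IsUnitPoissonProcess (N i) μ)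
    (hI : iIndepFun (fun i ω t => N i t ω) μ) :
    ∀ᵐ ω ∂μ, ∀ T : ℕ, ∃ n, n ≠ 0 ∧ ω ∉ badEvent N (T : ℝ≥0) n := by
  rw [ae_all_iff]
  intro T
  have h0 : μ.real {ω | ¬ ∃ n, n ≠ 0 ∧ ω ∉ badEvent N (T : ℝ≥0) n} ≤ 0 := by
    refine ge_of_tendsto (tendsto_measureReal_badEvent hN hI (T : ℝ≥0)) ?_
    filter_upwards [eventually_ne_atTop 0] with n hn
    refine measureReal_mono fun ω hω => ?_
    by_contra h
    exact hω ⟨n, hn, h⟩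
  rw [ae_iff]
  exact (measureReal_eq_zero_iff).1 (le_antisymm h0 measureReal_nonneg)

/-- Induction principle along paths: what composes over adjacent intervals need only be checked with
at most one ring. The null set is chosen before `r`, so `r` may depend on `ω`, and all pairs of
times are covered at once. -/
lemma ae_rel (hN : ∀ i, IsUnitPoissonProcess (N i) μ)
    (hI : iIndepFun (fun i ω t => N i t ω) μ) :
    ∀ᵐ ω ∂μ, ∀ r : ℝ≥0 → ℝ≥0 → Prop, (∀ a b c, a ≤ b → b ≤ c → r a b → r b c → r a c) →
      (∀ s t, s ≤ t → rings N s t ω ≤ 1 → r s t) → ∀ s t, s ≤ t → r s t := by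
  filter_upwards [ae_monotone hN, ae_exists_notMem_badEvent hN hI] with ω hm hω r h1 h2 s t hst
  obtain ⟨T, hT⟩ := exists_nat_ge t
  obtain ⟨n, hn, hbad⟩ := hω T
  exact rel_of_not_badEvent hm hn hbad r h1 h2 hst hT

lemma ae_strictMono (hx₀ : StrictMono x₀) (hξ : IsPushTASEP x₀ N ξ μ) :
    ∀ᵐ ω ∂μ, ∀ t, StrictMono (ξ t ω) := by
  filter_upwards [ae_rel hξ.poisson hξ.indep, ae_step hξ, hξ.start] with ω hrel hstep h0 t
  refine hrel (fun s t => StrictMono (ξ s ω) → StrictMono (ξ t ω))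
    (fun a b c _ _ h1 h2 h => h2 (h1 h)) (fun s t hst hR h => ?_) 0 t (zero_le) (h0 ▸ hx₀)
  rcases hstep s t hst hR with ⟨-, h'⟩ | ⟨i, -, h'⟩
  · rwa [h']
  · rw [h']; exact push_strictMono h i

lemma ae_bounds (hξ : IsPushTASEP x₀ N ξ μ) :
    ∀ᵐ ω ∂μ, ∀ s t, s ≤ t → ∀ j, ξ s ω j + incr N s t ω j ≤ ξ t ω j ∧
      ξ t ω j ≤ ξ s ω j + rings N s t ω := by
  filter_upwards [ae_monotone hξ.poisson, ae_rel hξ.poisson hξ.indep, ae_step hξ]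
    with ω hm hrel hstep
  refine hrel _ (fun a b c hab hbc h1 h2 j => ?_) (fun s t hst hR j => ?_)
  · have := h1 j
    have := h2 j
    rw [incr_add hm hab hbc, rings_add hm hab hbc]
    push_cast
    omega
  · rcases hstep s t hst hR with ⟨h, h'⟩ | ⟨i, h, h'⟩
    · rw [h', h]; simp
    · have h1 := incr_le_rings (N := N) (ω := ω) s t i
      have h2 := le_push i (ξ s ω) j
      have h3 := push_le i (ξ s ω) j
      rw [h] at h1 ⊢
      simp only [Pi.single_eq_same] at h1
      rw [h']
      by_cases hji : j = i
      · subst hji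
        simp only [push_self, Pi.single_eq_same]
        omega
      · simp only [Pi.single_eq_of_ne hji]
        omega

lemma ae_first_eq (hd : 0 < d) (hξ : IsPushTASEP x₀ N ξ μ) :
    ∀ᵐ ω ∂μ, ∀ s t, s ≤ t → ξ t ω ⟨0, hd⟩ = ξ s ω ⟨0, hd⟩ + incr N s t ω ⟨0, hd⟩ := by
  filter_upwards [ae_monotone hξ.poisson, ae_rel hξ.poisson hξ.indep, ae_step hξ]
    with ω hm hrel hstep
  refine hrel _ (fun a b c hab hbc h1 h2 => ?_) (fun s t hst hR => ?_)
  · rw [incr_add hm hab hbc, h2, h1]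
    push_cast
    ring
  · rcases hstep s t hst hR with ⟨h, h'⟩ | ⟨i, h, h'⟩
    · rw [h', h]; simp
    · rw [h', h]
      by_cases hi : i = ⟨0, hd⟩
      · subst hi; simp [push_self]
      · have : (⟨0, hd⟩ : Fin d) < i := by
          have : (i : ℕ) ≠ 0 := fun h => hi (Fin.ext h)
          simp only [Fin.lt_def]; omega
        rw [push_of_lt this, Pi.single_eq_of_ne (Ne.symm hi)]
        simp

end Path

/-! ### The configuration is independent of the future of the clocks -/

section Independence

variable {Ω : Type*} {d : ℕ}

open Classical in
/-- The effect of the rings `r` on a configuration, if there is at most one ring. -/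
noncomputable def jumpStep (r : Fin d → ℕ) (x : Fin d → ℤ) : Fin d → ℤ :=
  if h : ∃ i, r = Pi.single i 1 then push h.choose x else x

lemma jumpStep_zero (x : Fin d → ℤ) : jumpStep 0 x = x := by
  unfold jumpStep
  rw [dif_neg]
  rintro ⟨i, hi⟩
  simpa using congr_fun hi i

lemma jumpStep_single (i : Fin d) (x : Fin d → ℤ) : jumpStep (Pi.single i 1) x = push i x := by
  have h : ∃ k : Fin d, (Pi.single i 1 : Fin d → ℕ) = Pi.single k 1 := ⟨i, rfl⟩
  have hk : h.choose = i := by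
    by_contra hne
    have := congr_fun h.choose_spec i
    rw [Pi.single_eq_same, Pi.single_eq_of_ne (Ne.symm hne)] at this
    exact one_ne_zero this
  unfold jumpStep
  rw [dif_pos h, hk]

/-- The discrete chain driven by successive vectors of rings. -/
noncomputable def chain (x₀ : Fin d → ℤ) (r : ℕ → Fin d → ℕ) : ℕ → Fin d → ℤ
  | 0 => x₀
  | k + 1 => jumpStep (r k) (chain x₀ r k)

lemma chain_congr (x₀ : Fin d → ℤ) {r r' : ℕ → Fin d → ℕ} {n : ℕ} (h : ∀ k < n, r k = r' k) :
    chain x₀ r n = chain x₀ r' n := by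
  induction n with
  | zero => rfl
  | succ n ih =>
    simp only [chain]
    rw [h n n.lt_succ_self, ih fun k hk => h k (hk.trans n.lt_succ_self)]

variable [MeasurableSpace Ω] {μ : Measure Ω} {N : Fin d → ℝ≥0 → Ω → ℕ} {x₀ : Fin d → ℤ}
  {ξ : ℝ≥0 → Ω → Fin d → ℤ}

/-- Off `badEvent` every grid step has at most one ring, so the default value of `jumpStep` for
several rings never enters. -/
lemma ae_chain_eq (hξ : IsPushTASEP x₀ N ξ μ) (s : ℝ≥0) :
    ∀ᵐ ω ∂μ, ∀ n, ω ∉ badEvent N s n → ∀ k ≤ n,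
      chain x₀ (fun k => incr N (gridTime s n k) (gridTime s n (k + 1)) ω) k =
        ξ (gridTime s n k) ω := by
  filter_upwards [ae_step hξ, hξ.start] with ω hstep h0 n hbad k
  induction k with
  | zero => intro _; simp [chain, gridTime_zero, h0]
  | succ k ih =>
    intro hk
    have hR : rings N (gridTime s n k) (gridTime s n (k + 1)) ω ≤ 1 := by
      by_contra h
      exact hbad ⟨k, by omega, by omega⟩
    simp only [chain]
    rw [ih (by omega)]
    rcases hstep _ _ (gridTime_mono s n k.le_succ) hR with ⟨h, h'⟩ | ⟨i, h, h'⟩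
    · rw [h, h', jumpStep_zero]
    · rw [h, h', jumpStep_single]

lemma indepFun_chain_incr (hN : ∀ i, IsUnitPoissonProcess (N i) μ)
    (hI : iIndepFun (fun i ω t => N i t ω) μ) (x₀ : Fin d → ℤ) {s t : ℝ≥0} (hst : s ≤ t) {n : ℕ}
    (hn : n ≠ 0) :
    IndepFun (fun ω => chain x₀
      (fun k => incr N (gridTime s n k) (gridTime s n (k + 1)) ω) n) (incr N s t) μ := by
  classical
  -- The grid on `[0, s]` is prolonged by `t`, so that step `n` is the interval from `s` to `t`.
  set τ : ℕ → ℝ≥0 := fun k => if k ≤ n then gridTime s n k else t with hτ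
  have hτm : Monotone τ := by
    refine monotone_nat_of_le_succ fun k => ?_
    simp only [hτ]
    split_ifs with h1 h2 h2
    · exact gridTime_mono s n k.le_succ
    · exact (gridTime_mono s n h1).trans ((gridTime_self s hn).le.trans hst)
    · omega
    · exact le_rfl
  -- Joint independence over particles and steps: the clocks are independent of each other, and each
  -- has independent increments.
  have hind : iIndepFun (fun (p : Fin d × ℕ) ω => incr N (τ p.2) (τ (p.2 + 1)) ω p.1) μ := by
    refine iIndepFun_uncurry' (X := fun j k ω => incr N (τ k) (τ (k + 1)) ω j)
      (fun j k => ((hN j).measurable _).sub ((hN j).measurable _)) ?_ fun j => ?_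
    · exact hI.comp (fun _ f k => f (τ (k + 1)) - f (τ k)) fun _ => measurable_pi_lambda _ fun k =>
        (measurable_pi_apply _).sub (measurable_pi_apply _)
    · exact (hN j).indepIncrements.nat hτm
  have hdisj : Disjoint ((Finset.univ : Finset (Fin d)) ×ˢ Finset.range n)
      ((Finset.univ : Finset (Fin d)) ×ˢ {n}) := by
    rw [Finset.disjoint_left]
    rintro ⟨j, k⟩ h1 h2
    simp only [Finset.mem_product, Finset.mem_univ, true_and, Finset.mem_range,
      Finset.mem_singleton] at h1 h2
    omega
  have h := (hind.indepFun_finset _ _ hdisj fun p =>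
    ((hN p.1).measurable _).sub ((hN p.1).measurable _)).comp
    (φ := fun v => chain x₀ (fun k j => if hk : k < n then v ⟨(j, k), by simp [hk]⟩ else 0) n)
    (ψ := fun v j => v ⟨(j, n), by simp⟩) .of_discrete .of_discrete
  convert! h using 1
  · ext1 ω
    refine chain_congr x₀ fun k hk => funext fun j => ?_
    simp only [hk, dif_pos, hτ, hk.le, if_true, Nat.succ_le_of_lt hk]
  · ext ω j
    simp [hτ, gridTime_self s hn]

variable [IsProbabilityMeasure μ]

/-- Adaptedness of `ξ` is not part of the definition. It is recovered from the chains, which are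
functions of past increments and agree with `ξ s` with probability tending to one; the product
formula passes to the limit. -/
lemma indepFun_incr (hξ : IsPushTASEP x₀ N ξ μ) {s t : ℝ≥0} (hst : s ≤ t) :
    IndepFun (ξ s) (incr N s t) μ := by
  set X : ℕ → Ω → Fin d → ℤ := fun n ω => chain x₀
      (fun k => incr N (gridTime s n k) (gridTime s n (k + 1)) ω) n with hX
  have hne : Tendsto (fun n => μ.real {ω | X n ω ≠ ξ s ω}) atTop (𝓝 0) := by
    refine squeeze_zero' (.of_forall fun _ => measureReal_nonneg) ?_
      (tendsto_measureReal_badEvent hξ.poisson hξ.indep s)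
    filter_upwards [eventually_ne_atTop 0] with n hn
    refine ENNReal.toReal_mono (measure_ne_top _ _) (measure_mono_ae ?_)
    filter_upwards [ae_chain_eq hξ s] with ω hω hne
    by_contra hbad
    apply hne
    have := hω n hbad n le_rfl
    rwa [gridTime_self s hn] at this
  have hlim : ∀ (A : Set (Fin d → ℤ)) (C : Set Ω),
      Tendsto (fun n => μ.real (X n ⁻¹' A ∩ C)) atTop (𝓝 (μ.real (ξ s ⁻¹' A ∩ C))) := by
    intro A C
    rw [tendsto_iff_norm_sub_tendsto_zero]
    refine squeeze_zero (fun _ => norm_nonneg _) (fun n => ?_) hne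
    have h1 : X n ⁻¹' A ∩ C ⊆ (ξ s ⁻¹' A ∩ C) ∪ {ω | X n ω ≠ ξ s ω} := by
      rintro ω ⟨hA, hC⟩
      by_cases h : X n ω = ξ s ω
      · left; exact ⟨by rwa [Set.mem_preimage, ← h], hC⟩
      · right; exact h
    have h2 : ξ s ⁻¹' A ∩ C ⊆ (X n ⁻¹' A ∩ C) ∪ {ω | X n ω ≠ ξ s ω} := by
      rintro ω ⟨hA, hC⟩
      by_cases h : X n ω = ξ s ω
      · left; exact ⟨by rwa [Set.mem_preimage, h], hC⟩
      · right; exact h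
    have h3 := (measureReal_mono (μ := μ) h1).trans (measureReal_union_le _ _)
    have h4 := (measureReal_mono (μ := μ) h2).trans (measureReal_union_le _ _)
    rw [Real.norm_eq_abs, abs_le]
    constructor <;> linarith
  rw [indepFun_iff_measure_inter_preimage_eq_mul]
  intro A B hA hB
  have h1 := hlim A (incr N s t ⁻¹' B)
  have h2 := (hlim A Set.univ).mul_const (μ.real (incr N s t ⁻¹' B))
  simp only [Set.inter_univ] at h2
  have h3 := tendsto_nhds_unique_of_eventuallyEq h1 h2 ?_
  · rw [measureReal_def, measureReal_def, measureReal_def, ← ENNReal.toReal_mul] at h3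
    exact (ENNReal.toReal_eq_toReal_iff' (measure_ne_top _ _)
      (ENNReal.mul_ne_top (measure_ne_top _ _) (measure_ne_top _ _))).1 h3
  · filter_upwards [eventually_ne_atTop 0] with n hn
    have := (indepFun_chain_incr hξ.poisson hξ.indep x₀ hst hn).measure_inter_preimage_eq_mul
      A B hA hB
    simp only [measureReal_def]
    rw [← ENNReal.toReal_mul]
    exact congr_arg _ this

end Independence

/-! ### One-step estimates and the generator inequality -/

section Generator

variable {Ω : Type*} {d : ℕ}

/-- The size of a configuration. -/
def size (x : Fin d → ℤ) : ℝ := 1 + ∑ j, |(x j : ℝ)|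

lemma one_le_size (x : Fin d → ℤ) : 1 ≤ size x := by
  have : 0 ≤ ∑ j, |(x j : ℝ)| := Finset.sum_nonneg fun _ _ => abs_nonneg _
  unfold size
  linarith

lemma QuadGrowth.abs_push_sub_le {c : ℝ} {f : (Fin d → ℤ) → ℝ} (hf : QuadGrowth c f) (j : Fin d)
    (x : Fin d → ℤ) : |f (push j x) - f x| ≤ c * size x := by
  have := hf x (push j x) 1 le_rfl fun i => ⟨le_push j x i, push_le j x i⟩
  simpa [size] using this

lemma succ_sq_le_two_pow (n : ℕ) : ((n : ℝ) + 1) ^ 2 ≤ 8 * 2 ^ n := by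
  rcases Nat.eq_zero_or_pos n with rfl | hn
  · norm_num
  · have h := sq_le_excess (n := n + 1) (by omega)
    unfold excess at h
    rw [pow_succ (2 : ℝ) n] at h
    push_cast at h
    have : (0 : ℝ) ≤ n := n.cast_nonneg
    linarith

variable [MeasurableSpace Ω] {μ : Measure Ω} {N : Fin d → ℝ≥0 → Ω → ℕ} {x₀ : Fin d → ℤ}
  {ξ : ℝ≥0 → Ω → Fin d → ℤ}

lemma aestronglyMeasurable_comp (hξ : IsPushTASEP x₀ N ξ μ) (f : (Fin d → ℤ) → ℝ) (t : ℝ≥0) :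
    AEStronglyMeasurable (fun ω => f (ξ t ω)) μ :=
  ((Measurable.of_discrete (f := f)).comp (hξ.measurable t)).aestronglyMeasurable

lemma integrable_incr (hξ : IsPushTASEP x₀ N ξ μ) {s t : ℝ≥0} (hst : s ≤ t) (j : Fin d) :
    Integrable (fun ω => (incr N s t ω j : ℝ)) μ :=
  hasLaw_integrable_comp (hasLaw_incr hξ.poisson hst j) _ (integrable_id_poisson _)

lemma integral_incr (hξ : IsPushTASEP x₀ N ξ μ) {s t : ℝ≥0} (hst : s ≤ t) (j : Fin d) :
    ∫ ω, (incr N s t ω j : ℝ) ∂μ = t - s := by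
  have h := (hasLaw_incr hξ.poisson hst j).integral_comp (f := fun n : ℕ => (n : ℝ))
    .of_discrete
  rw [integral_id_poisson] at h
  convert! h using 1
  push_cast [NNReal.coe_sub hst]
  rfl

variable [IsProbabilityMeasure μ]

lemma ae_bounds_start (hξ : IsPushTASEP x₀ N ξ μ) (t : ℝ≥0) :
    ∀ᵐ ω ∂μ, ∀ j, x₀ j ≤ ξ t ω j ∧ ξ t ω j ≤ x₀ j + rings N 0 t ω := by
  filter_upwards [ae_bounds hξ, hξ.start] with ω hb h0 j
  have := hb 0 t (zero_le) j
  rw [h0] at this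
  omega

lemma integrable_rings (hξ : IsPushTASEP x₀ N ξ μ) {s t : ℝ≥0} (hst : s ≤ t) :
    Integrable (fun ω => (rings N s t ω : ℝ)) μ :=
  hasLaw_integrable_comp (hasLaw_rings hξ.poisson hξ.indep hst) _ (integrable_id_poisson _)

lemma integral_rings (hξ : IsPushTASEP x₀ N ξ μ) {s t : ℝ≥0} (hst : s ≤ t) :
    ∫ ω, (rings N s t ω : ℝ) ∂μ = d * (t - s) := by
  have h := (hasLaw_rings hξ.poisson hξ.indep hst).integral_comp (f := fun n : ℕ => (n : ℝ))
    .of_discrete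
  rw [integral_id_poisson] at h
  convert! h using 1
  push_cast [NNReal.coe_sub hst]
  rfl

lemma ae_size_le (hξ : IsPushTASEP x₀ N ξ μ) (t : ℝ≥0) :
    ∀ᵐ ω ∂μ, size (ξ t ω) ≤ size x₀ + d * rings N 0 t ω := by
  filter_upwards [ae_bounds_start hξ t] with ω h
  have : ∀ j, |(ξ t ω j : ℝ)| ≤ |(x₀ j : ℝ)| + rings N 0 t ω := fun j => by
    have h1 : (x₀ j : ℝ) ≤ ξ t ω j := by exact_mod_cast (h j).1
    have h2 : (ξ t ω j : ℝ) ≤ x₀ j + rings N 0 t ω := by exact_mod_cast (h j).2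
    have h3 := neg_abs_le (x₀ j : ℝ)
    have h4 := le_abs_self (x₀ j : ℝ)
    rw [abs_le]; constructor <;> linarith
  have h' := Finset.sum_le_sum fun j (_ : j ∈ Finset.univ) => this j
  rw [Finset.sum_add_distrib] at h'
  simp at h'
  unfold size
  linarith

lemma integrable_size (hξ : IsPushTASEP x₀ N ξ μ) (t : ℝ≥0) :
    Integrable (fun ω => size (ξ t ω)) μ := by
  refine Integrable.mono' ((integrable_const (size x₀)).add
    ((integrable_rings hξ (zero_le (a := t))).const_mul (d : ℝ)))
    (aestronglyMeasurable_comp hξ size t) ?_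
  filter_upwards [ae_size_le hξ t] with ω h
  rw [Real.norm_eq_abs, abs_of_nonneg (zero_le_one.trans (one_le_size _))]
  exact h

lemma integral_size_le (hξ : IsPushTASEP x₀ N ξ μ) (t : ℝ≥0) :
    ∫ ω, size (ξ t ω) ∂μ ≤ size x₀ + d * (d * t) := by
  have hi := (integrable_rings hξ (zero_le (a := t))).const_mul (d : ℝ)
  refine (integral_mono_ae (integrable_size hξ t) ((integrable_const (size x₀)).add hi)
    (ae_size_le hξ t)).trans (le_of_eq ?_)
  change ∫ ω, (size x₀ + d * (rings N 0 t ω : ℝ)) ∂μ = _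
  rw [integral_add (integrable_const _) hi, integral_const_mul,
    integral_rings hξ (zero_le (a := t))]
  simp

lemma QuadGrowth.integrable {c : ℝ} {f : (Fin d → ℤ) → ℝ} (hf : QuadGrowth c f)
    (hξ : IsPushTASEP x₀ N ξ μ) (t : ℝ≥0) : Integrable (fun ω => f (ξ t ω)) μ := by
  have h2 : Integrable (fun ω => (2 : ℝ) ^ rings N 0 t ω) μ :=
    hasLaw_integrable_comp (hasLaw_rings hξ.poisson hξ.indep (zero_le (a := t))) (fun n => 2 ^ n)
      (integrable_two_pow_poisson _)
  refine Integrable.mono' ((integrable_const |f x₀|).add (h2.const_mul (|c| * size x₀ * 8)))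
    (aestronglyMeasurable_comp hξ f t) ?_
  filter_upwards [ae_bounds_start hξ t] with ω h
  -- One is added to the number of rings because `QuadGrowth` requires `1 ≤ R`.
  have h1 := hf x₀ (ξ t ω) (rings N 0 t ω + 1) (by omega) fun j => ⟨(h j).1, by
    have := (h j).2; push_cast; omega⟩
  push_cast at h1
  have h3 := succ_sq_le_two_pow (rings N 0 t ω)
  have h4 := one_le_size x₀
  have h5 : |f (ξ t ω)| ≤ |f x₀| + |f (ξ t ω) - f x₀| := by
    have := abs_add_le (f x₀) (f (ξ t ω) - f x₀)
    rwa [add_sub_cancel] at this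
  rw [Real.norm_eq_abs]
  refine h5.trans (add_le_add_right (h1.trans ?_) _)
  change c * size x₀ * _ ≤ _
  calc c * size x₀ * ((rings N 0 t ω : ℝ) + 1) ^ 2
      ≤ |c| * size x₀ * (8 * 2 ^ rings N 0 t ω) := by
        gcongr
        exact le_abs_self c
    _ = _ := by ring

/-- To first order, the change of `f` during `(s, t]` is the sum of the effects of the rings. -/
lemma ae_abs_sub_sum_le {c : ℝ} (hc : 0 ≤ c) {f : (Fin d → ℤ) → ℝ} (hf : QuadGrowth c f)
    (hξ : IsPushTASEP x₀ N ξ μ) :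
    ∀ᵐ ω ∂μ, ∀ s t, s ≤ t →
      |f (ξ t ω) - f (ξ s ω) - ∑ j, (f (push j (ξ s ω)) - f (ξ s ω)) * (incr N s t ω j : ℝ)| ≤
        8 * c * (size (ξ s ω) * excess (rings N s t ω)) := by
  filter_upwards [ae_bounds hξ, ae_step hξ] with ω hb hstep s t hst
  have hs := one_le_size (ξ s ω)
  have he := excess_nonneg (rings N s t ω)
  rcases le_or_gt (rings N s t ω) 1 with hR | hR
  · have h0 : f (ξ t ω) - f (ξ s ω) -
        ∑ j, (f (push j (ξ s ω)) - f (ξ s ω)) * (incr N s t ω j : ℝ) = 0 := by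
      rcases hstep s t hst hR with ⟨h, h'⟩ | ⟨i, h, h'⟩
      · rw [h, h']; simp
      · rw [h, h', Finset.sum_eq_single i]
        · simp
        · intro j _ hj
          simp [hj]
        · simp
    rw [h0, abs_zero]
    positivity
  · have h1 := hf (ξ s ω) (ξ t ω) (rings N s t ω) (by omega) fun j => by
      have := hb s t hst j; omega
    change _ ≤ c * size (ξ s ω) * _ at h1
    have h2 : |∑ j, (f (push j (ξ s ω)) - f (ξ s ω)) * (incr N s t ω j : ℝ)| ≤
        c * size (ξ s ω) * (rings N s t ω : ℝ) := by
      refine (Finset.abs_sum_le_sum_abs _ _).trans ?_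
      unfold rings
      push_cast
      rw [Finset.mul_sum]
      refine Finset.sum_le_sum fun j _ => ?_
      rw [abs_mul, Nat.abs_cast]
      gcongr
      exact hf.abs_push_sub_le j _
    have h3 := sq_le_excess hR
    have h4 : (2 : ℝ) ≤ rings N s t ω := by exact_mod_cast hR
    have hcs : 0 ≤ c * size (ξ s ω) := by positivity
    -- With `R` rings, `R ≥ 2`, both `R ^ 2` and `R` are at most `4 * excess R`, whence the constant
    -- 8.
    calc _ ≤ c * size (ξ s ω) * (rings N s t ω : ℝ) ^ 2 +
          c * size (ξ s ω) * (rings N s t ω : ℝ) := (abs_sub _ _).trans (add_le_add h1 h2)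
      _ ≤ c * size (ξ s ω) * (8 * excess (rings N s t ω)) := by
          rw [← mul_add]
          gcongr
          nlinarith
      _ = _ := by ring

lemma integrable_push_sub {c : ℝ} {f : (Fin d → ℤ) → ℝ} (hf : QuadGrowth c f)
    (hξ : IsPushTASEP x₀ N ξ μ) (s : ℝ≥0) (j : Fin d) :
    Integrable (fun ω => f (push j (ξ s ω)) - f (ξ s ω)) μ :=
  Integrable.mono' ((integrable_size hξ s).const_mul c)
    (aestronglyMeasurable_comp hξ (fun x => f (push j x) - f x) s)
    (.of_forall fun _ => hf.abs_push_sub_le j _)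

lemma integrable_gen {c : ℝ} {f : (Fin d → ℤ) → ℝ} (hf : QuadGrowth c f)
    (hξ : IsPushTASEP x₀ N ξ μ) (s : ℝ≥0) : Integrable (fun ω => gen f (ξ s ω)) μ :=
  integrable_finsetSum _ fun j _ => integrable_push_sub hf hξ s j

/-- One-step estimate: the expectation of `f` changes at the rate given by the generator. -/
lemma abs_integral_sub_le {c : ℝ} (hc : 0 ≤ c) {f : (Fin d → ℤ) → ℝ} (hf : QuadGrowth c f)
    (hξ : IsPushTASEP x₀ N ξ μ) {s t : ℝ≥0} (hst : s ≤ t) :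
    |∫ ω, f (ξ t ω) ∂μ - ∫ ω, f (ξ s ω) ∂μ - (t - s) * ∫ ω, gen f (ξ s ω) ∂μ| ≤
      8 * c * ((∫ ω, size (ξ s ω) ∂μ) *
        (Real.exp (d * (t - s)) - 1 - d * (t - s))) := by
  -- Independence factorizes both the first-order term and the error bound into a moment at time `s`
  -- and a Poisson moment.
  have hind := indepFun_incr hξ hst
  have hprod : ∀ j, Integrable
      (fun ω => (f (push j (ξ s ω)) - f (ξ s ω)) * (incr N s t ω j : ℝ)) μ := fun j =>
    (hind.comp (φ := fun x => f (push j x) - f x) (ψ := fun r : Fin d → ℕ => ((r j : ℕ) : ℝ))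
      .of_discrete .of_discrete).integrable_mul (integrable_push_sub hf hξ s j)
      (integrable_incr hξ hst j)
  have hint : ∫ ω, ∑ j, (f (push j (ξ s ω)) - f (ξ s ω)) * (incr N s t ω j : ℝ) ∂μ =
      (t - s) * ∫ ω, gen f (ξ s ω) ∂μ := by
    unfold gen
    rw [integral_finsetSum _ fun j _ => hprod j,
      integral_finsetSum _ fun j _ => integrable_push_sub hf hξ s j, Finset.mul_sum]
    refine Finset.sum_congr rfl fun j _ => ?_
    rw [← integral_incr hξ hst j, mul_comm]
    exact (hind.comp (φ := fun x => f (push j x) - f x) (ψ := fun r : Fin d → ℕ => ((r j : ℕ) : ℝ))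
      .of_discrete .of_discrete).integral_fun_mul_eq_mul_integral
      (integrable_push_sub hf hξ s j).aestronglyMeasurable
      (integrable_incr hξ hst j).aestronglyMeasurable
  have hlaw := hasLaw_rings hξ.poisson hξ.indep hst
  have hie : Integrable (fun ω => excess (rings N s t ω)) μ :=
    hasLaw_integrable_comp hlaw _ (integrable_excess_poisson _)
  have hindr := hind.comp (φ := size) (ψ := fun r => excess (∑ j, r j)) .of_discrete .of_discrete
  have hse : Integrable (fun ω => size (ξ s ω) * excess (rings N s t ω)) μ :=
    hindr.integrable_mul (integrable_size hξ s) hie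
  have hise : ∫ ω, size (ξ s ω) * excess (rings N s t ω) ∂μ = (∫ ω, size (ξ s ω) ∂μ) *
        (Real.exp (d * (t - s)) - 1 - d * (t - s)) := by
    have h1 : ∫ ω, excess (rings N s t ω) ∂μ = Real.exp (d * (t - s)) - 1 - d * (t - s) := by
      have := hlaw.integral_comp (f := excess) .of_discrete
      rw [integral_excess_poisson] at this
      convert! this using 1
      push_cast [NNReal.coe_sub hst]
      rfl
    rw [← h1]
    exact hindr.integral_fun_mul_eq_mul_integral (integrable_size hξ s).aestronglyMeasurable
      hie.aestronglyMeasurable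
  have hd : Integrable (fun ω => f (ξ t ω) - f (ξ s ω)) μ :=
    (hf.integrable hξ t).sub (hf.integrable hξ s)
  rw [← hint, ← integral_sub (hf.integrable hξ t) (hf.integrable hξ s),
    ← integral_sub hd (integrable_finsetSum _ fun j _ => hprod j), ← hise, ← integral_const_mul]
  refine (abs_integral_le_integral_abs).trans (integral_mono_ae
    (hd.sub (integrable_finsetSum _ fun j _ => hprod j)).abs (hse.const_mul _) ?_)
  filter_upwards [ae_abs_sub_sum_le hc hf hξ] with ω h
  exact h s t hst

end Generator

/-! ### The time on the boundary -/

section BoundaryTime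

variable {Ω : Type*} {d : ℕ} {ξ : ℝ≥0 → Ω → Fin d → ℤ}

lemma boundarySet_subset (T : ℝ≥0) (ω : Ω) :
    {t : ℝ | 0 ≤ t ∧ t ≤ (T : ℝ) ∧ gap (ξ t.toNNReal ω) ∈ boundary (d - 1)} ⊆
      Set.Icc 0 (T : ℝ) := fun _ h => ⟨h.1, h.2.1⟩

lemma boundaryTime_nonneg (T : ℝ≥0) (ω : Ω) : 0 ≤ boundaryTime ξ T ω := ENNReal.toReal_nonneg

lemma boundaryTime_le (T : ℝ≥0) (ω : Ω) : boundaryTime ξ T ω ≤ T := by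
  refine (ENNReal.toReal_mono (by simp) (measure_mono (boundarySet_subset T ω))).trans ?_
  simp

lemma boundaryTime_zero (ω : Ω) : boundaryTime ξ 0 ω = 0 :=
  le_antisymm (boundaryTime_le 0 ω) (boundaryTime_nonneg 0 ω)

lemma boundaryTime_sub {s t : ℝ≥0} (hst : s ≤ t) (ω : Ω) :
    boundaryTime ξ t ω - boundaryTime ξ s ω =
      volume.real {u : ℝ | u ∈ Set.Ioc (s : ℝ) t ∧ gap (ξ u.toNNReal ω) ∈ boundary (d - 1)} := by
  have hst' : (s : ℝ) ≤ t := hst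
  have hs0 : (0 : ℝ) ≤ s := s.2
  set A := {u : ℝ | 0 ≤ u ∧ u ≤ (t : ℝ) ∧ gap (ξ u.toNNReal ω) ∈ boundary (d - 1)} with hA
  have hfin : volume A ≠ ⊤ :=
    ((measure_mono (boundarySet_subset t ω)).trans_lt (by simp)).ne
  -- Only the half-line has to be measurable here; `A` may be an arbitrary set of times.
  have h := measureReal_inter_add_sdiff (μ := volume) (s := A) (t := Set.Iic (s : ℝ))
    measurableSet_Iic hfin
  have h1 : A ∩ Set.Iic (s : ℝ) =
      {u : ℝ | 0 ≤ u ∧ u ≤ (s : ℝ) ∧ gap (ξ u.toNNReal ω) ∈ boundary (d - 1)} := by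
    ext u
    simp only [hA, Set.mem_inter_iff, Set.mem_ofPred_eq, Set.mem_Iic]
    constructor
    · rintro ⟨⟨h1, h2, h3⟩, h4⟩; exact ⟨h1, h4, h3⟩
    · rintro ⟨h1, h2, h3⟩; exact ⟨⟨h1, h2.trans hst', h3⟩, h2⟩
  have h2 : A \ Set.Iic (s : ℝ) =
      {u : ℝ | u ∈ Set.Ioc (s : ℝ) t ∧ gap (ξ u.toNNReal ω) ∈ boundary (d - 1)} := by
    ext u
    simp only [hA, Set.mem_sdiff, Set.mem_ofPred_eq, Set.mem_Iic, not_le, Set.mem_Ioc]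
    constructor
    · rintro ⟨⟨h1, h2, h3⟩, h4⟩; exact ⟨⟨h4, h2⟩, h3⟩
    · rintro ⟨⟨h1, h2⟩, h3⟩; exact ⟨⟨hs0.trans h1.le, h2, h3⟩, h1⟩
  rw [h1, h2] at h
  change volume.real A - volume.real _ = _
  linarith

lemma boundaryTime_sub_mem_Icc {s t : ℝ≥0} (hst : s ≤ t) (ω : Ω) :
    boundaryTime ξ t ω - boundaryTime ξ s ω ∈ Set.Icc (0 : ℝ) (t - s) := by
  rw [boundaryTime_sub hst]
  refine ⟨measureReal_nonneg, (measureReal_mono (s₂ := Set.Ioc (s : ℝ) t) (fun u h => h.1)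
    (by simp)).trans (le_of_eq ?_)⟩
  rw [Real.volume_real_Ioc_of_le (NNReal.coe_le_coe.2 hst)]

variable [MeasurableSpace Ω] {μ : Measure Ω}
  {N : Fin d → ℝ≥0 → Ω → ℕ} {x₀ : Fin d → ℤ}

/-- Without rings the configuration is constant and the left side is zero; with a ring the trivial
bound `t - s` suffices. -/
lemma ae_abs_boundaryTime_sub_le (hξ : IsPushTASEP x₀ N ξ μ) :
    ∀ᵐ ω ∂μ, ∀ s t, s ≤ t →
      |boundaryTime ξ t ω - boundaryTime ξ s ω - (t - s) * bdryInd (ξ s ω)| ≤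
        (t - s) * (rings N s t ω : ℝ) := by
  filter_upwards [ae_monotone hξ.poisson, ae_step hξ] with ω hm hstep s t hst
  have hst' : (0 : ℝ) ≤ t - s := sub_nonneg.2 hst
  obtain ⟨h0, h1⟩ := boundaryTime_sub_mem_Icc (ξ := ξ) hst ω
  have h2 := bdryInd_nonneg (ξ s ω)
  have h3 := bdryInd_le_one (ξ s ω)
  rcases Nat.eq_zero_or_pos (rings N s t ω) with hR | hR
  · have hconst : ∀ u ∈ Set.Ioc (s : ℝ) t, ξ u.toNNReal ω = ξ s ω := by
      intro u hu
      have hsu : s ≤ u.toNNReal := NNReal.le_toNNReal_of_coe_le hu.1.le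
      have hut : u.toNNReal ≤ t := Real.toNNReal_le_iff_le_coe.2 hu.2
      have hR' : rings N s u.toNNReal ω = 0 := by
        have := rings_mono hm le_rfl hsu hut
        omega
      rcases hstep s u.toNNReal hsu (by omega) with ⟨-, h⟩ | ⟨i, h, -⟩
      · exact h
      · have := incr_le_rings (N := N) (ω := ω) s u.toNNReal i
        rw [h, hR'] at this
        simp at this
    rw [hR, boundaryTime_sub hst]
    unfold bdryInd
    split_ifs with hB
    · have : {u : ℝ | u ∈ Set.Ioc (s : ℝ) t ∧ gap (ξ u.toNNReal ω) ∈ boundary (d - 1)} =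
          Set.Ioc (s : ℝ) t := by
        ext u
        refine ⟨fun h => h.1, fun h => ⟨h, ?_⟩⟩
        rw [hconst u h]; exact hB
      rw [this, Real.volume_real_Ioc_of_le (NNReal.coe_le_coe.2 hst)]
      simp
    · have : {u : ℝ | u ∈ Set.Ioc (s : ℝ) t ∧ gap (ξ u.toNNReal ω) ∈ boundary (d - 1)} = ∅ := by
        ext u
        simp only [Set.mem_ofPred_eq, Set.mem_empty_iff_false, iff_false]
        rintro ⟨h, h'⟩
        rw [hconst u h] at h'
        exact hB h'
      rw [this]
      simp
  · have hR' : (1 : ℝ) ≤ rings N s t ω := by exact_mod_cast hR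
    have h4 := mul_le_of_le_one_right hst' h3
    have h5 := mul_nonneg hst' h2
    have h6 := le_mul_of_one_le_right hst' hR'
    rw [abs_le]
    constructor <;> linarith

/-- The Riemann sum of the boundary time on the uniform grid. -/
noncomputable def boundarySum (ξ : ℝ≥0 → Ω → Fin d → ℤ) (T : ℝ≥0) (n : ℕ) (ω : Ω) : ℝ :=
  ∑ k ∈ Finset.range n, (T / n : ℝ) * bdryInd (ξ (gridTime T n k) ω)

lemma ae_abs_boundaryTime_sub_boundarySum_le (hξ : IsPushTASEP x₀ N ξ μ) (T : ℝ≥0) :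
    ∀ᵐ ω ∂μ, ∀ n, n ≠ 0 → |boundaryTime ξ T ω - boundarySum ξ T n ω| ≤
      (T / n : ℝ) * (rings N 0 T ω : ℝ) := by
  filter_upwards [ae_abs_boundaryTime_sub_le hξ, ae_monotone hξ.poisson] with ω h hm n hn
  have htel := Finset.sum_range_sub (fun k => boundaryTime ξ (gridTime T n k) ω) n
  rw [gridTime_self T hn, gridTime_zero, boundaryTime_zero, sub_zero] at htel
  rw [← htel, boundarySum, ← Finset.sum_sub_distrib]
  refine (Finset.abs_sum_le_sum_abs _ _).trans ?_
  have hrs := sum_rings_gridTime hm T n n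
  rw [gridTime_self T hn] at hrs
  rw [← hrs]
  push_cast
  rw [Finset.mul_sum]
  refine Finset.sum_le_sum fun k _ => ?_
  have := h _ _ (gridTime_mono T n k.le_succ)
  simp only [Nat.succ_eq_add_one, coe_gridTime_succ, add_sub_cancel_left] at this
  exact this

variable [IsProbabilityMeasure μ]

lemma integrable_bdryInd (hξ : IsPushTASEP x₀ N ξ μ) (t : ℝ≥0) :
    Integrable (fun ω => bdryInd (ξ t ω)) μ :=
  Integrable.mono' (integrable_const 1) (aestronglyMeasurable_comp hξ bdryInd t)
    (.of_forall fun ω => by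
      rw [Real.norm_eq_abs, abs_of_nonneg (bdryInd_nonneg _)]; exact bdryInd_le_one _)

lemma integrable_boundarySum (hξ : IsPushTASEP x₀ N ξ μ) (T : ℝ≥0) (n : ℕ) :
    Integrable (boundarySum ξ T n) μ :=
  integrable_finsetSum _ fun _ _ => (integrable_bdryInd hξ _).const_mul _

/-- Measurability in `ω` comes from the almost sure convergence of the Riemann sums; the boundary
time is bounded by `T`. -/
lemma integrable_boundaryTime (hξ : IsPushTASEP x₀ N ξ μ) (T : ℝ≥0) :
    Integrable (boundaryTime ξ T) μ := by
  have hlim : ∀ᵐ ω ∂μ, Tendsto (fun n => boundarySum ξ T n ω) atTop (𝓝 (boundaryTime ξ T ω)) := by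
    filter_upwards [ae_abs_boundaryTime_sub_boundarySum_le hξ T] with ω h
    rw [tendsto_iff_norm_sub_tendsto_zero]
    have h0 : Tendsto (fun n : ℕ => (T / n : ℝ) * (rings N 0 T ω : ℝ)) atTop (𝓝 0) := by
      simpa using (tendsto_const_div_atTop_nhds_zero_nat (T : ℝ)).mul_const (rings N 0 T ω : ℝ)
    refine squeeze_zero' (.of_forall fun _ => norm_nonneg _) ?_ h0
    filter_upwards [eventually_ne_atTop 0] with n hn
    rw [Real.norm_eq_abs, abs_sub_comm]
    exact h n hn
  refine Integrable.mono' (integrable_const (T : ℝ))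
    (aestronglyMeasurable_of_tendsto_ae atTop
      (fun n => (integrable_boundarySum hξ T n).aestronglyMeasurable) hlim)
    (.of_forall fun ω => ?_)
  rw [Real.norm_eq_abs, abs_of_nonneg (boundaryTime_nonneg _ _)]
  exact boundaryTime_le T ω

lemma abs_integral_boundaryTime_sub_le (hξ : IsPushTASEP x₀ N ξ μ) (T : ℝ≥0) {n : ℕ}
    (hn : n ≠ 0) :
    |∫ ω, boundaryTime ξ T ω ∂μ -
      ∑ k ∈ Finset.range n, (T / n : ℝ) * ∫ ω, bdryInd (ξ (gridTime T n k) ω) ∂μ| ≤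
      (T / n : ℝ) * (d * T) := by
  have h1 : ∑ k ∈ Finset.range n, (T / n : ℝ) * ∫ ω, bdryInd (ξ (gridTime T n k) ω) ∂μ =
      ∫ ω, boundarySum ξ T n ω ∂μ := by
    unfold boundarySum
    rw [integral_finsetSum _ fun _ _ => (integrable_bdryInd hξ _).const_mul _]
    simp_rw [integral_const_mul]
  have h2 := integral_rings hξ (zero_le (a := T))
  simp only [NNReal.coe_zero, sub_zero] at h2
  rw [h1, ← integral_sub (integrable_boundaryTime hξ T) (integrable_boundarySum hξ T n),
    ← h2, ← integral_const_mul]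
  refine (abs_integral_le_integral_abs).trans (integral_mono_ae
    ((integrable_boundaryTime hξ T).sub (integrable_boundarySum hξ T n)).abs
    ((integrable_rings hξ (zero_le (a := T))).const_mul _) ?_)
  filter_upwards [ae_abs_boundaryTime_sub_boundarySum_le hξ T] with ω h
  exact h n hn

/-- If the generator applied to `f` is at most `a + b 1_B`, with `B` the set of configurations
whose gap vector is on the boundary, then the expectation of `f` grows accordingly. -/
theorem integral_le_of_gen_le (hx₀ : StrictMono x₀) (hξ : IsPushTASEP x₀ N ξ μ) {c : ℝ}
    (hc : 0 ≤ c) {f : (Fin d → ℤ) → ℝ} (hf : QuadGrowth c f) {a b : ℝ}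
    (hgen : ∀ x, StrictMono x → gen f x ≤ a + b * bdryInd x) (T : ℝ≥0) :
    ∫ ω, f (ξ T ω) ∂μ ≤ f x₀ + a * T + b * ∫ ω, boundaryTime ξ T ω ∂μ := by
  set K := size x₀ + d * (d * (T : ℝ)) with hK
  set P : ℝ≥0 → ℝ := fun t => ∫ ω, bdryInd (ξ t ω) ∂μ with hP
  have hgenP : ∀ t, ∫ ω, gen f (ξ t ω) ∂μ ≤ a + b * P t := by
    intro t
    have hi := (integrable_bdryInd hξ t).const_mul b
    calc ∫ ω, gen f (ξ t ω) ∂μ ≤ ∫ ω, (a + b * bdryInd (ξ t ω)) ∂μ := by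
          refine integral_mono_ae (integrable_gen hf hξ t) ((integrable_const a).add hi) ?_
          filter_upwards [ae_strictMono hx₀ hξ] with ω h
          exact hgen _ (h t)
      _ = a + b * P t := by
          rw [integral_add (integrable_const _) hi, integral_const_mul]
          simp [hP]
  have hbound : ∀ n : ℕ, n ≠ 0 → ∫ ω, f (ξ T ω) ∂μ ≤
      f x₀ + a * T + b * ∫ ω, boundaryTime ξ T ω ∂μ + |b| * ((T / n : ℝ) * (d * T)) +
        8 * c * K * (n * (Real.exp ((d * T : ℝ) / n) - 1 - (d * T : ℝ) / n)) := by
    intro n hn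
    have hn' : (n : ℝ) ≠ 0 := by exact_mod_cast hn
    set ψ := Real.exp ((d * T : ℝ) / n) - 1 - (d * T : ℝ) / n with hψ
    have hψ0 : 0 ≤ ψ := by
      have := Real.add_one_le_exp ((d * T : ℝ) / n); linarith
    have hstep : ∀ k ∈ Finset.range n, ∫ ω, f (ξ (gridTime T n (k + 1)) ω) ∂μ -
        ∫ ω, f (ξ (gridTime T n k) ω) ∂μ ≤
          a * (T / n) + b * (T / n * P (gridTime T n k)) + 8 * c * K * ψ := by
      intro k hk
      have h := abs_integral_sub_le hc hf hξ (gridTime_mono T n k.le_succ)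
      simp only [Nat.succ_eq_add_one, coe_gridTime_succ, add_sub_cancel_left] at h
      rw [← mul_div_assoc, ← hψ] at h
      have h1 := (abs_le.1 h).2
      have hkT : (gridTime T n k : ℝ) ≤ T := by
        have := gridTime_mono T n (Finset.mem_range.1 hk).le
        rwa [gridTime_self T hn] at this
      have h2 : ∫ ω, size (ξ (gridTime T n k) ω) ∂μ ≤ K := by
        refine (integral_size_le hξ _).trans ?_
        rw [hK]; gcongr
      have h3 : 8 * c * ((∫ ω, size (ξ (gridTime T n k) ω) ∂μ) * ψ) ≤ 8 * c * K * ψ := by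
        rw [← mul_assoc]; gcongr
      have h4 : (T / n : ℝ) * ∫ ω, gen f (ξ (gridTime T n k) ω) ∂μ ≤
          T / n * (a + b * P (gridTime T n k)) := by
        gcongr
        exact hgenP _
      linarith
    have hsum := Finset.sum_le_sum hstep
    rw [Finset.sum_range_sub (fun k => ∫ ω, f (ξ (gridTime T n k) ω) ∂μ), gridTime_self T hn,
      gridTime_zero, Finset.sum_add_distrib, Finset.sum_add_distrib, Finset.sum_const,
      Finset.sum_const, Finset.card_range, nsmul_eq_mul, nsmul_eq_mul, ← Finset.mul_sum] at hsum
    have h0 : ∫ ω, f (ξ 0 ω) ∂μ = f x₀ := by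
      rw [integral_congr_ae (g := fun _ => f x₀)]
      · simp
      · filter_upwards [hξ.start] with ω h
        rw [h]
    have hB := abs_integral_boundaryTime_sub_le hξ T hn
    -- The sign of `b` is not fixed, so the two-sided Riemann sum estimate is used, at the price of
    -- `|b|`.
    have hb : b * (∑ k ∈ Finset.range n, (T / n : ℝ) * P (gridTime T n k)) ≤
        b * ∫ ω, boundaryTime ξ T ω ∂μ + |b| * ((T / n : ℝ) * (d * T)) := by
      have h5 := mul_le_mul_of_nonneg_left hB (abs_nonneg b)
      rw [← abs_mul] at h5
      have h6 := (abs_le.1 h5).1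
      rw [mul_sub] at h6
      linarith
    have ha : (n : ℝ) * (a * (T / n)) = a * T := by field_simp
    rw [h0, ha] at hsum
    linarith
  have hlim : Tendsto (fun n : ℕ => f x₀ + a * T + b * ∫ ω, boundaryTime ξ T ω ∂μ +
      |b| * ((T / n : ℝ) * (d * T)) +
        8 * c * K * (n * (Real.exp ((d * T : ℝ) / n) - 1 - (d * T : ℝ) / n))) atTop
      (𝓝 (f x₀ + a * T + b * ∫ ω, boundaryTime ξ T ω ∂μ + |b| * (0 * (d * T)) +
        8 * c * K * 0)) :=
    (tendsto_const_nhds.add (((tendsto_const_div_atTop_nhds_zero_nat (T : ℝ)).mul_const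
      (d * T : ℝ)).const_mul _)).add ((tendsto_nat_mul_exp_div (d * T)).const_mul _)
  rw [zero_mul, mul_zero, mul_zero, add_zero, add_zero] at hlim
  refine ge_of_tendsto hlim ?_
  filter_upwards [eventually_ne_atTop 0] with n hn
  exact hbound n hn

end BoundaryTime

/-! ### Growth of the gaps, positions and boundary time -/

section Growth

variable {Ω : Type*} {d : ℕ} [MeasurableSpace Ω] {μ : Measure Ω} {N : Fin d → ℝ≥0 → Ω → ℕ}
  {x₀ : Fin d → ℤ} {ξ : ℝ≥0 → Ω → Fin d → ℤ}

lemma one_le_sqrt {T : ℝ≥0} (hT : 1 ≤ T) : 1 ≤ Real.sqrt (T : ℝ) :=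
  Real.one_le_sqrt.2 (by exact_mod_cast hT)

/-- The characteristic function of the difference of two independent Poisson variables. -/
lemma integral_cexp_sub {X Y : Ω → ℕ} {r : ℝ≥0} (hXY : IndepFun X Y μ)
    (hX : HasLaw X (poissonMeasure r) μ) (hY : HasLaw Y (poissonMeasure r) μ) (θ : ℝ) :
    ∫ ω, Complex.exp (Complex.I * ((θ * ((X ω : ℝ) - Y ω) : ℝ) : ℂ)) ∂μ =
      (Real.exp (2 * r * (Real.cos θ - 1)) : ℂ) := by
  have hchar : ∀ (Z : Ω → ℕ), HasLaw Z (poissonMeasure r) μ → ∀ u : ℝ,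
      ∫ ω, Complex.exp (u * (Z ω : ℝ) * Complex.I) ∂μ =
        Complex.exp (r * (Complex.exp (u * Complex.I) - 1)) := by
    intro Z hZ u
    rw [← charFun_map_cast_poissonMeasure, charFun_apply_real,
      integral_map .of_discrete (by fun_prop),
      ← hZ.integral_comp .of_discrete]
    rfl
  have hprod := (hXY.comp (φ := fun n : ℕ => Complex.exp (θ * (n : ℝ) * Complex.I))
    (ψ := fun n : ℕ => Complex.exp ((-θ : ℝ) * (n : ℝ) * Complex.I))
    .of_discrete .of_discrete).integral_fun_mul_eq_mul_integral
      ((Measurable.of_discrete.comp_aemeasurable hX.aemeasurable).aestronglyMeasurable)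
      ((Measurable.of_discrete.comp_aemeasurable hY.aemeasurable).aestronglyMeasurable)
  simp only [Function.comp_apply] at hprod
  rw [hchar X hX, hchar Y hY, ← Complex.exp_add] at hprod
  have h1 : (fun ω => Complex.exp (Complex.I * ((θ * ((X ω : ℝ) - Y ω) : ℝ) : ℂ))) =
      fun ω => Complex.exp (θ * (X ω : ℝ) * Complex.I) *
        Complex.exp ((-θ : ℝ) * (Y ω : ℝ) * Complex.I) := by
    ext ω
    rw [← Complex.exp_add]
    congr 1
    push_cast
    ring
  rw [h1, hprod, Complex.ofReal_exp]
  congr 1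
  push_cast
  rw [Complex.exp_mul_I, Complex.exp_mul_I, Complex.cos_neg, Complex.sin_neg]
  ring

variable [IsProbabilityMeasure μ]

lemma integrable_apply (hξ : IsPushTASEP x₀ N ξ μ) (T : ℝ≥0) (j : Fin d) :
    Integrable (fun ω => (ξ T ω j : ℝ)) μ :=
  (quadGrowth_apply j).integrable hξ T

lemma integral_first (hd : 0 < d) (hξ : IsPushTASEP x₀ N ξ μ) (T : ℝ≥0) :
    ∫ ω, (ξ T ω ⟨0, hd⟩ : ℝ) ∂μ = x₀ ⟨0, hd⟩ + T := by
  have h : ∫ ω, (ξ T ω ⟨0, hd⟩ : ℝ) ∂μ =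
      ∫ ω, ((x₀ ⟨0, hd⟩ : ℝ) + (incr N 0 T ω ⟨0, hd⟩ : ℝ)) ∂μ := by
    refine integral_congr_ae ?_
    filter_upwards [ae_first_eq hd hξ, hξ.start] with ω h h0
    rw [h 0 T (zero_le), h0]
    push_cast
    rfl
  rw [h, integral_add (integrable_const _) (integrable_incr hξ (zero_le (a := T)) _),
    integral_incr hξ (zero_le (a := T))]
  simp

lemma le_integral_apply (hξ : IsPushTASEP x₀ N ξ μ) (T : ℝ≥0) (j : Fin d) :
    (x₀ j : ℝ) + T ≤ ∫ ω, (ξ T ω j : ℝ) ∂μ := by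
  have hi := integrable_incr hξ (zero_le (a := T)) j
  have h := integral_mono_ae ((integrable_const (x₀ j : ℝ)).add hi) (integrable_apply hξ T j) (by
    filter_upwards [ae_bounds hξ, hξ.start] with ω h h0
    have := (h 0 T (zero_le) j).1
    rw [h0] at this
    simp only [Pi.add_apply]
    exact_mod_cast this)
  refine le_trans (le_of_eq ?_) h
  change _ = ∫ ω, ((x₀ j : ℝ) + (incr N 0 T ω j : ℝ)) ∂μ
  rw [integral_add (integrable_const _) hi, integral_incr hξ (zero_le (a := T))]
  simp

lemma exists_integral_gap_le (hx₀ : StrictMono x₀) (hξ : IsPushTASEP x₀ N ξ μ) :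
    ∃ C : ℝ, 0 ≤ C ∧ ∀ T : ℝ≥0, 1 ≤ T → ∀ i : Fin (d - 1),
      ∫ ω, (gap (ξ T ω) i : ℝ) ∂μ ≤ C * Real.sqrt T := by
  set V : ℝ := ∑ i, (gap x₀ i : ℝ) ^ 2 with hV
  have hV0 : 0 ≤ V := Finset.sum_nonneg fun _ _ => sq_nonneg _
  refine ⟨V + d ^ 2 + 1, by positivity, fun T hT i => ?_⟩
  have hs := one_le_sqrt hT
  have hss : Real.sqrt T * Real.sqrt T = T := Real.mul_self_sqrt T.2
  have hq : QuadGrowth _ (fun y : Fin d → ℤ => ∑ i, (gap y i : ℝ) ^ 2) :=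
    QuadGrowth.sum Finset.univ fun i _ => quadGrowth_gap_sq i
  have h1 := integral_le_of_gen_le hx₀ hξ (by positivity) hq (a := (d : ℝ) ^ 2) (b := 0)
    (fun x hx => by rw [zero_mul, add_zero]; exact gen_sum_gap_sq_le hx) T
  rw [zero_mul, add_zero] at h1
  have hgi : Integrable (fun ω => (gap (ξ T ω) i : ℝ) ^ 2) μ := (quadGrowth_gap_sq i).integrable hξ T
  have h2 : ∫ ω, (gap (ξ T ω) i : ℝ) ^ 2 ∂μ ≤ V + d ^ 2 * T := by
    refine le_trans (integral_mono hgi (hq.integrable hξ T) fun ω => ?_) h1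
    exact Finset.single_le_sum (f := fun i => (gap (ξ T ω) i : ℝ) ^ 2)
      (fun _ _ => sq_nonneg _) (Finset.mem_univ i)
  have hg1 : Integrable (fun ω => (gap (ξ T ω) i : ℝ)) μ := by
    simp only [gap]
    push_cast
    exact ((integrable_apply hξ T _).sub (integrable_apply hξ T _)).sub (integrable_const _)
  -- The pointwise bound `√T g ≤ g ^ 2 + T` replaces Cauchy–Schwarz; dividing by `√T` gives the mean
  -- gap.
  have h3 : ∫ ω, Real.sqrt T * (gap (ξ T ω) i : ℝ) ∂μ ≤
      ∫ ω, ((gap (ξ T ω) i : ℝ) ^ 2 + T) ∂μ := by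
    refine integral_mono (hg1.const_mul _) (hgi.add (integrable_const _)) fun ω => ?_
    nlinarith [sq_nonneg ((gap (ξ T ω) i : ℝ) - Real.sqrt T), sq_nonneg (gap (ξ T ω) i : ℝ),
      T.2]
  rw [integral_const_mul, integral_add hgi (integrable_const _)] at h3
  simp only [integral_const, probReal_univ, one_smul] at h3
  have h4 : Real.sqrt T * ∫ ω, (gap (ξ T ω) i : ℝ) ∂μ ≤
      Real.sqrt T * ((V + d ^ 2 + 1) * Real.sqrt T) := by
    have : (1 : ℝ) ≤ T := by exact_mod_cast hT
    calc _ ≤ V + d ^ 2 * T + T := by linarith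
      _ ≤ (V + d ^ 2 + 1) * T := by nlinarith
      _ = _ := by linear_combination -(V + d ^ 2 + 1) * hss
  exact le_of_mul_le_mul_left h4 (by linarith)

lemma exists_integral_apply_le (hd : 0 < d) (hx₀ : StrictMono x₀) (hξ : IsPushTASEP x₀ N ξ μ) :
    ∃ C : ℝ, 0 ≤ C ∧ ∀ T : ℝ≥0, 1 ≤ T → ∀ j : Fin d,
      ∫ ω, (ξ T ω j : ℝ) ∂μ ≤ T + C * Real.sqrt T := by
  obtain ⟨C, hC, h⟩ := exists_integral_gap_le hx₀ hξ
  refine ⟨|(x₀ ⟨0, hd⟩ : ℝ)| + d * (C + 1), by positivity, fun T hT j => ?_⟩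
  have hs := one_le_sqrt hT
  -- Neighbours differ by the gap plus one; the one is absorbed through `1 ≤ √T`, hence `C + 1`.
  have key : ∀ k (hk : k < d), ∫ ω, (ξ T ω ⟨k, hk⟩ : ℝ) ∂μ ≤
      x₀ ⟨0, hd⟩ + T + k * ((C + 1) * Real.sqrt T) := by
    intro k
    induction k with
    | zero => intro hk; rw [integral_first hd hξ T]; simp
    | succ k ih =>
      intro hk
      have h1 := h T hT ⟨k, by omega⟩
      simp only [gap] at h1
      push_cast at h1
      have hi : Integrable
          (fun ω => (ξ T ω ⟨k + 1, hk⟩ : ℝ) - ξ T ω ⟨k, by omega⟩) μ :=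
        (integrable_apply hξ T _).sub (integrable_apply hξ T _)
      rw [integral_sub hi (integrable_const _), integral_sub (integrable_apply hξ T _) (integrable_apply hξ T _)]
        at h1
      simp only [integral_const, probReal_univ, one_smul] at h1
      have h2 := ih (by omega)
      push_cast
      linarith
  have hj : (j : ℝ) ≤ d := by exact_mod_cast j.2.le
  have h1 := le_abs_self (x₀ ⟨0, hd⟩ : ℝ)
  have h2 := abs_nonneg (x₀ ⟨0, hd⟩ : ℝ)
  calc _ ≤ (x₀ ⟨0, hd⟩ : ℝ) + T + (j : ℕ) * ((C + 1) * Real.sqrt T) := key j j.2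
    _ ≤ |(x₀ ⟨0, hd⟩ : ℝ)| * Real.sqrt T + T + d * ((C + 1) * Real.sqrt T) := by
        gcongr
        nlinarith
    _ = _ := by ring

lemma exists_integral_boundaryTime_le (hd : 0 < d) (hx₀ : StrictMono x₀)
    (hξ : IsPushTASEP x₀ N ξ μ) :
    ∃ C : ℝ, ∀ T : ℝ≥0, 1 ≤ T → ∫ ω, boundaryTime ξ T ω ∂μ ≤ C * Real.sqrt T := by
  obtain ⟨C, hC, h⟩ := exists_integral_apply_le hd hx₀ hξ
  set S : ℝ := ∑ j, (x₀ j : ℝ) with hS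
  refine ⟨d * C + |S|, fun T hT => ?_⟩
  have hs := one_le_sqrt hT
  have hq : QuadGrowth _ (fun y : Fin d → ℤ => ∑ j, (y j : ℝ)) :=
    QuadGrowth.sum Finset.univ fun j _ => quadGrowth_apply j
  -- The upper bound on drifts is applied to minus the sum, turning `le_gen_sum` into a lower bound
  -- for the mean total position.
  have h1 := integral_le_of_gen_le hx₀ hξ (by positivity) hq.neg (a := -(d : ℝ)) (b := -1)
    (fun x _ => by
      have h1 := le_gen_sum x
      have h2 : gen (fun y : Fin d → ℤ => -∑ j, (y j : ℝ)) x =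
          -gen (fun y : Fin d → ℤ => ∑ j, (y j : ℝ)) x := by
        unfold gen
        rw [← Finset.sum_neg_distrib]
        exact Finset.sum_congr rfl fun j _ => by ring
      rw [h2]
      linarith) T
  rw [integral_neg, integral_finsetSum _ fun j _ => integrable_apply hξ T j] at h1
  have h2 := Finset.sum_le_sum fun j (_ : j ∈ Finset.univ) => h T hT j
  simp only [Finset.sum_const, Finset.card_univ, Fintype.card_fin, nsmul_eq_mul] at h2
  have h3 := neg_abs_le S
  have h4 := mul_le_mul_of_nonneg_left hs (abs_nonneg S)
  linarith

/-- Since `|exp(iu) - 1| ≤ |u|`, a characteristic function bounded away from 1 at `θ` forces a first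
absolute moment of order `1/θ`; the choice `θ = 1/√T` is the diffusive scale. -/
lemma mul_sqrt_le_integral_abs_sub {X Y : Ω → ℕ} {T : ℝ≥0} (hT : 1 ≤ T) (hXY : IndepFun X Y μ)
    (hX : HasLaw X (poissonMeasure T) μ) (hY : HasLaw Y (poissonMeasure T) μ) :
    (1 - Real.exp (-(1 / 2))) * Real.sqrt T ≤ ∫ ω, |(X ω : ℝ) - Y ω| ∂μ := by
  have hs := one_le_sqrt hT
  have hss : Real.sqrt T ^ 2 = T := Real.sq_sqrt T.2
  set θ : ℝ := (Real.sqrt T)⁻¹ with hθ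
  have hθ0 : 0 < θ := by positivity
  have hθ1 : θ ≤ 1 := inv_le_one_of_one_le₀ hs
  have hθT : (T : ℝ) * θ ^ 2 = 1 := by
    rw [← hss, hθ, inv_pow]
    exact mul_inv_cancel₀ (by positivity)
  have hint : Integrable (fun ω => |(X ω : ℝ) - Y ω|) μ :=
    ((hasLaw_integrable_comp hX _ (integrable_id_poisson T)).sub
      (hasLaw_integrable_comp hY _ (integrable_id_poisson T))).abs
  -- The Taylor bound gives `cos θ - 1 ≤ -θ ^ 2 / 4` for `θ ≤ 1`, and `T θ ^ 2 = 1`.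
  have hcos : 2 * T * (Real.cos θ - 1) ≤ -(1 / 2) := by
    have h1 := (abs_le.1 (Real.cos_bound (by rwa [abs_of_pos hθ0] : |θ| ≤ 1))).2
    rw [abs_of_pos hθ0] at h1
    have h2 : θ ^ 4 ≤ θ ^ 2 := pow_le_pow_of_le_one hθ0.le hθ1 (by norm_num)
    have h3 : Real.cos θ - 1 ≤ -(θ ^ 2 / 4) := by nlinarith
    calc 2 * (T : ℝ) * (Real.cos θ - 1) ≤ 2 * T * (-(θ ^ 2 / 4)) := by gcongr
      _ = -(T * θ ^ 2) / 2 := by ring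
      _ = -(1 / 2) := by rw [hθT]; norm_num
  have hmeas : AEStronglyMeasurable
      (fun ω => Complex.exp (Complex.I * ((θ * ((X ω : ℝ) - Y ω) : ℝ) : ℂ))) μ := by
    have hx := (Measurable.of_discrete (f := fun n : ℕ => (n : ℝ))).comp_aemeasurable hX.aemeasurable
    have hy := (Measurable.of_discrete (f := fun n : ℕ => (n : ℝ))).comp_aemeasurable hY.aemeasurable
    have hm : Measurable fun u : ℝ => Complex.exp (Complex.I * ((θ * u : ℝ) : ℂ)) := by fun_prop
    exact (hm.comp_aemeasurable (hx.sub hy)).aestronglyMeasurable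
  have hexp : Integrable
      (fun ω => Complex.exp (Complex.I * ((θ * ((X ω : ℝ) - Y ω) : ℝ) : ℂ))) μ :=
    Integrable.of_bound hmeas 1 (.of_forall fun ω => by
      rw [mul_comm, Complex.norm_exp_ofReal_mul_I])
  have hkey : 1 - Real.exp (2 * T * (Real.cos θ - 1)) ≤ θ * ∫ ω, |(X ω : ℝ) - Y ω| ∂μ := by
    have h1 : ‖∫ ω, (Complex.exp (Complex.I * ((θ * ((X ω : ℝ) - Y ω) : ℝ) : ℂ)) - 1) ∂μ‖ ≤
        ∫ ω, θ * |(X ω : ℝ) - Y ω| ∂μ := by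
      refine norm_integral_le_of_norm_le (hint.const_mul θ) (.of_forall fun ω => ?_)
      refine (Real.norm_exp_I_mul_ofReal_sub_one_le).trans ?_
      rw [Real.norm_eq_abs, abs_mul, abs_of_pos hθ0]
    rw [integral_sub hexp (integrable_const _), integral_cexp_sub hXY hX hY,
      integral_const_mul] at h1
    simp only [integral_const, probReal_univ, one_smul] at h1
    refine le_trans ?_ h1
    rw [← Complex.ofReal_one, ← Complex.ofReal_sub, Complex.norm_real, Real.norm_eq_abs,
      abs_sub_comm]
    exact le_abs_self _
  have hfin : 1 - Real.exp (-(1 / 2)) ≤ θ * ∫ ω, |(X ω : ℝ) - Y ω| ∂μ :=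
    le_trans (sub_le_sub_left (Real.exp_le_exp.2 hcos) _) hkey
  have h := mul_le_mul_of_nonneg_right hfin (by positivity : 0 ≤ Real.sqrt T)
  refine h.trans (le_of_eq ?_)
  rw [hθ]
  field_simp

lemma le_integral_boundaryTime (hd : 2 ≤ d) (hx₀ : StrictMono x₀) (hξ : IsPushTASEP x₀ N ξ μ)
    {T : ℝ≥0} (hT : 1 ≤ T) :
    (1 - Real.exp (-(1 / 2))) / 2 * Real.sqrt T + ((x₀ ⟨0, by omega⟩ : ℝ) - x₀ ⟨1, hd⟩) ≤
      ∫ ω, boundaryTime ξ T ω ∂μ := by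
  set a : Fin d := ⟨0, by omega⟩ with ha
  set b : Fin d := ⟨1, hd⟩ with hb
  have hab : a < b := by simp [ha, hb]
  have h1 := integral_le_of_gen_le hx₀ hξ zero_le_one (quadGrowth_apply b) (a := 1) (b := 1)
    (fun x hx => by rw [one_mul]; exact gen_second_le hd hx) T
  have h2 := integral_first (by omega) hξ T
  rw [← ha] at h2
  have hlaw : ∀ j, HasLaw (fun ω => incr N 0 T ω j) (poissonMeasure T) μ := fun j => by
    simpa using hasLaw_incr hξ.poisson (zero_le (a := T)) j
  have h3 := mul_sqrt_le_integral_abs_sub hT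
    ((iIndepFun_incr hξ.indep 0 T).indepFun hab.ne') (hlaw b) (hlaw a)
  have hib := integrable_incr hξ (zero_le (a := T)) b
  have hia := integrable_incr hξ (zero_le (a := T)) a
  have hD : Integrable (fun ω => (incr N 0 T ω b : ℝ) - incr N 0 T ω a) μ := hib.sub hia
  -- With `D` the difference of the ring counts, `|D| + D` is twice the positive part of `D`. The
  -- distance is at least `D`, since the first particle moves only at its own rings, and it is
  -- nonnegative by ordering. The mean of `D` is zero.
  have h4 : ∫ ω, (|(incr N 0 T ω b : ℝ) - incr N 0 T ω a| +
      ((incr N 0 T ω b : ℝ) - incr N 0 T ω a)) ∂μ ≤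
      ∫ ω, 2 * ((ξ T ω b : ℝ) - ξ T ω a) ∂μ := by
    refine integral_mono_ae (hD.abs.add hD)
      (((integrable_apply hξ T b).sub (integrable_apply hξ T a)).const_mul 2) ?_
    filter_upwards [ae_bounds hξ, ae_first_eq (by omega) hξ, hξ.start, ae_strictMono hx₀ hξ]
      with ω hbd hf h0 hsm
    have e1 := (hbd 0 T (zero_le) b).1
    have e2 := hf 0 T (zero_le)
    rw [← ha] at e2
    rw [h0] at e1 e2
    have e3 := hsm T hab
    have e4 := hx₀ hab
    have e5 : (incr N 0 T ω b : ℝ) - incr N 0 T ω a ≤ (ξ T ω b : ℝ) - ξ T ω a := by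
      have : (incr N 0 T ω b : ℤ) - incr N 0 T ω a ≤ ξ T ω b - ξ T ω a := by omega
      exact_mod_cast this
    have e6 : (0 : ℝ) ≤ (ξ T ω b : ℝ) - ξ T ω a := by
      have : (0 : ℤ) ≤ ξ T ω b - ξ T ω a := by omega
      exact_mod_cast this
    rcases abs_cases ((incr N 0 T ω b : ℝ) - incr N 0 T ω a) with ⟨h, _⟩ | ⟨h, _⟩ <;>
      simp only [h] <;> linarith
  rw [integral_add hD.abs hD, integral_sub hib hia, integral_incr hξ (zero_le (a := T)),
    integral_incr hξ (zero_le (a := T)), integral_const_mul,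
    integral_sub (integrable_apply hξ T b) (integrable_apply hξ T a)] at h4
  linarith

end Growth

end PushTASEP

/-! ### Assembly of the asymptotic bounds -/

theorem theorem2p4 {Ω : Type*} [MeasurableSpace Ω] (μ : Measure Ω) [IsProbabilityMeasure μ]
    (d : ℕ) (hd : 2 ≤ d) (x₀ : Fin d → ℤ) (hx₀ : StrictMono x₀)
    (N : Fin d → ℝ≥0 → Ω → ℕ) (ξ : ℝ≥0 → Ω → Fin d → ℤ)
    (hξ : PushTASEP.IsPushTASEP x₀ N ξ μ) :
    ((∀ T, Integrable (PushTASEP.boundaryTime ξ T) μ) ∧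
      (fun T : ℝ≥0 => ∫ ω, PushTASEP.boundaryTime ξ T ω ∂μ) =Θ[atTop]
        fun T : ℝ≥0 => Real.sqrt (T : ℝ)) ∧
    ∀ i : Fin d,
      (∀ T, Integrable (fun ω => (ξ T ω i : ℝ)) μ) ∧
      (fun T : ℝ≥0 => (∫ ω, (ξ T ω i : ℝ) ∂μ) - (T : ℝ)) =O[atTop]
        fun T : ℝ≥0 => Real.sqrt (T : ℝ) := by
  have hd0 : 0 < d := by omega
  have hnn : ∀ T : ℝ≥0, 0 ≤ ∫ ω, PushTASEP.boundaryTime ξ T ω ∂μ := fun T =>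
    integral_nonneg fun ω => PushTASEP.boundaryTime_nonneg T ω
  refine ⟨⟨PushTASEP.integrable_boundaryTime hξ, ?_, ?_⟩, fun i =>
    ⟨fun T => PushTASEP.integrable_apply hξ T i, ?_⟩⟩
  · obtain ⟨C, h⟩ := PushTASEP.exists_integral_boundaryTime_le hd0 hx₀ hξ
    refine IsBigO.of_bound C ?_
    filter_upwards [eventually_ge_atTop 1] with T hT
    rw [Real.norm_of_nonneg (hnn T), Real.norm_of_nonneg (Real.sqrt_nonneg _)]
    exact h T hT
  · set c : ℝ := (1 - Real.exp (-(1 / 2))) / 2 with hc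
    have hc0 : 0 < c := by
      have : Real.exp (-(1 / 2)) < 1 := by
        rw [← Real.exp_zero]; exact Real.exp_lt_exp.2 (by norm_num)
      rw [hc]; linarith
    set D : ℝ := (x₀ ⟨1, hd⟩ : ℝ) - x₀ ⟨0, hd0⟩ with hD
    -- The lower bound is `c √T - D`; half of `c √T` absorbs `D` once `√T ≥ 2 D / c`.
    refine IsBigO.of_bound (2 / c) ?_
    have hlim : Tendsto (fun T : ℝ≥0 => Real.sqrt (T : ℝ)) atTop atTop :=
      Real.tendsto_sqrt_atTop.comp (NNReal.tendsto_coe_atTop.2 tendsto_id)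
    filter_upwards [eventually_ge_atTop 1, hlim.eventually_ge_atTop (2 * D / c)] with T hT hDT
    rw [Real.norm_of_nonneg (hnn T), Real.norm_of_nonneg (Real.sqrt_nonneg _)]
    have h := PushTASEP.le_integral_boundaryTime hd hx₀ hξ hT
    rw [← hc] at h
    rw [div_le_iff₀ hc0] at hDT
    rw [div_mul_eq_mul_div, le_div_iff₀ hc0]
    linarith
  · obtain ⟨C, hC, h⟩ := PushTASEP.exists_integral_apply_le hd0 hx₀ hξ
    refine IsBigO.of_bound (C + |(x₀ i : ℝ)|) ?_
    filter_upwards [eventually_ge_atTop 1] with T hT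
    have hs := PushTASEP.one_le_sqrt hT
    have h1 := h T hT i
    have h2 := PushTASEP.le_integral_apply hξ T i
    have h3 := neg_abs_le (x₀ i : ℝ)
    have h4 := mul_le_mul_of_nonneg_left hs (abs_nonneg (x₀ i : ℝ))
    have h5 : 0 ≤ C * Real.sqrt T := by positivity
    have h6 : 0 ≤ |(x₀ i : ℝ)| * Real.sqrt T := by positivity
    rw [Real.norm_of_nonneg (Real.sqrt_nonneg _), Real.norm_eq_abs, abs_le]
    constructor <;> linarith
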